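/- For all $p,n\ge 1$ let $X_{pn}$ be a random real $p\times n$ matrix whose columns are independent and identically distributed copies of a random vector $x_p$ in $\mathbb{R}^p$, all random elements being defined on one probability space (nothing is assumed about the joint law of the matrices $X_{pn}$ for different $(p,n)$). Assume (A) for every sequence of complex $p\times p$ matrices $A_p$, $p\ge1$, with $\sup_p\|A_p\|<\infty$ (spectral norm), $\dfrac{x_p^\top A_p x_p-\operatorname{tr}A_p}{p}\to 0$ in probability as $p\to\infty$. Let $c>0$ and let $p=p(n)$ be any sequence with $p(n)/n\to c$ as $n\to\infty$. Let $\mu_{pn}=\frac1p\sum_{i=1}^p\delta_{\lambda_i}$ be the empirical spectral distribution of $n^{-1}X_{pn}X_{pn}^\top$, where $\lambda_1\le\dots\le\lambda_p$ are its eigenvalues with multiplicity, and let $\mu_c$ be the Marchenko–Pastur law $$\mu_c(dx)=\max\{1-1/c,0\}\,\delta_0(dx)+\frac{\sqrt{(b-x)(x-a)}}{2\pi c x}\,\mathbf 1_{[a,b]}(x)\,dx,\qquad a=(1-\sqrt c)^2,\quad b=(1+\sqrt c)^2 .$$ Then, with probability one, $\mu_{p(n)\,n}$ converges weakly to $\mu_c$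 as $n\to\infty$. -/

import Mathlib

open MeasureTheory ProbabilityTheory Filter Topology
open scoped ENNReal Matrix BoundedContinuousFunction

noncomputable section

namespace MarchenkoPastur

/-- The empirical spectral distribution `p⁻¹ ∑ᵢ δ_{λᵢ}` of a real symmetric `p × p` matrix,
the `λᵢ` being its eigenvalues counted with multiplicity. -/
def esd {p : ℕ} {A : Matrix (Fin p) (Fin p) ℝ} (hA : A.IsHermitian) : Measure ℝ :=
  (p : ℝ≥0∞)⁻¹ • ∑ i : Fin p, Measure.dirac (hA.eigenvalues i)

/-- The matrix `n⁻¹ X Xᵀ` of a real `p × n` matrix `X`. -/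
def sampleCov {p n : ℕ} (X : Matrix (Fin p) (Fin n) ℝ) : Matrix (Fin p) (Fin p) ℝ :=
  (n : ℝ)⁻¹ • (X * Xᵀ)

theorem sampleCov_isHermitian {p n : ℕ} (X : Matrix (Fin p) (Fin n) ℝ) :
    (sampleCov X).IsHermitian := by
  simp [Matrix.IsHermitian, sampleCov, Matrix.conjTranspose_eq_transpose_of_trivial]

/-- The Marchenko–Pastur law with parameter `c > 0`. -/
def mpLaw (c : ℝ) : Measure ℝ :=
  ENNReal.ofReal (max (1 - 1 / c) 0) • Measure.dirac 0 +
    (volume.restrict (Set.Icc ((1 - √c) ^ 2) ((1 + √c) ^ 2))).withDensity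
      (fun x => ENNReal.ofReal
        (√(((1 + √c) ^ 2 - x) * (x - (1 - √c) ^ 2)) / (2 * Real.pi * c * x)))

/-- Weak convergence (convergence in distribution) of measures on the real line:
convergence of the integrals of all bounded continuous functions. -/
def WeaklyConverges (ν : ℕ → Measure ℝ) (ν' : Measure ℝ) : Prop :=
  ∀ f : ℝ →ᵇ ℝ, Tendsto (fun n => ∫ t, f t ∂(ν n)) atTop (𝓝 (∫ t, f t ∂ν'))

/-- The spectral norm of a complex square matrix: the operator norm for Euclidean norms. -/
def matSpectralNorm {p : ℕ} (A : Matrix (Fin p) (Fin p) ℂ) : ℝ :=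
  ‖Matrix.toEuclideanCLM (n := Fin p) (𝕜 := ℂ) A‖

/-- The quadratic form `vᵀ A v` of a complex matrix at a real vector. -/
def quadForm {p : ℕ} (A : Matrix (Fin p) (Fin p) ℂ) (v : Fin p → ℝ) : ℂ :=
  (fun i => (v i : ℂ)) ⬝ᵥ (A *ᵥ (fun i => (v i : ℂ)))

/-- Assumption (A): `(x_pᵀ A_p x_p - tr A_p) / p → 0` in probability for all sequences of complex
`p × p` matrices `A_p` with uniformly bounded spectral norms. -/
def AssumptionA {Ω : Type*} [MeasurableSpace Ω] (P : Measure Ω)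
    (x : (p : ℕ) → Ω → Fin p → ℝ) : Prop :=
  ∀ A : (p : ℕ) → Matrix (Fin p) (Fin p) ℂ,
    (∃ K : ℝ, ∀ p, matSpectralNorm (A p) ≤ K) →
    TendstoInMeasure P
      (fun (p : ℕ) (ω : Ω) => (quadForm (A p) (x p ω) - (A p).trace) / (p : ℂ))
      atTop (fun _ => (0 : ℂ))

end MarchenkoPastur

end

/-! Let `r(t)` be the normalized trace of `(n⁻¹XXᵀ + t)⁻¹`, the Stieltjes transform of the spectral
distribution at `-t`. For measures on `[0, ∞)`, weak convergence follows from convergence of `r(t)`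
at the countably many points `t = 1 + 1/(m+1)` (`weaklyConverges_of_stieltjes`), so real `t > 0`
suffices and no complex analysis is needed.

Changing one column is a change between two rank-one perturbations of the same matrix and moves `r`
by at most `1/(tp)`. McDiarmid's inequality then makes `r` concentrate around its mean `m` with a
tail exponentially small in `n`. Borel–Cantelli gives `r - m → 0` almost surely, whatever the joint
law over different `n` (`ae_tendsto_resolventTrace_sub_integral`).

For the mean, the trace of `M⁻¹M` and Sherman–Morrison express `r` exactly through the forms `q_k =
Y_kᵀ M_k⁻¹ Y_k`, where `M_k` omits the column `Y_k` and hence is independent of it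
(`trace_shiftedGram_inv`). Assumption (A), made uniform over resolvents (`AssumptionA.uniform`),
replaces `q_k` by `tr M_k⁻¹`, and this is close to `p m`. Hence `m` almost solves `t m + m/(1 +
(p/n) m) = 1` (`abs_fixedPoint_resolventTrace_le`). The equation is stable, and an explicit
integration shows that the Marchenko–Pastur transform solves it with `c` in place of `p/n`
(`integral_mpLaw_inv_add_eq`). -/

open scoped NNReal

namespace MarchenkoPastur

/-! ### Weak convergence from Stieltjes transforms at countably many points -/

/-- The function `x ↦ (1 + |x|)⁻¹`, which maps `[0, ∞)` homeomorphically onto `(0, 1]`. -/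
noncomputable def invOneAdd : ℝ →ᵇ ℝ :=
  BoundedContinuousFunction.ofNormedAddCommGroup (fun x : ℝ => (1 + |x|)⁻¹)
    (Continuous.inv₀ (by fun_prop) fun x => by positivity) 1 (fun x => by
      rw [Real.norm_of_nonneg (by positivity)]
      exact inv_le_one_of_one_le₀ (by linarith [abs_nonneg x]))

theorem invOneAdd_apply (x : ℝ) : invOneAdd x = (1 + |x|)⁻¹ := rfl

theorem invOneAdd_pos (x : ℝ) : 0 < invOneAdd x := by
  rw [invOneAdd_apply]; positivity

theorem invOneAdd_le_one (x : ℝ) : invOneAdd x ≤ 1 := by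
  rw [invOneAdd_apply]; exact inv_le_one_of_one_le₀ (by linarith [abs_nonneg x])

/-- The function `(1 + s u)⁻¹` with `u = invOneAdd`. -/
noncomputable def invOneAddMul (s : ℝ) (hs : 0 ≤ s) : ℝ →ᵇ ℝ :=
  BoundedContinuousFunction.ofNormedAddCommGroup (fun x : ℝ => (1 + s * invOneAdd x)⁻¹)
    (Continuous.inv₀ (by fun_prop) fun x => by
      have := (invOneAdd_pos x).le
      positivity) 1 (fun x => by
      have := mul_nonneg hs (invOneAdd_pos x).le
      rw [Real.norm_of_nonneg (by positivity)]
      exact inv_le_one_of_one_le₀ (by linarith))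

theorem invOneAddMul_apply (s : ℝ) (hs : 0 ≤ s) (x : ℝ) :
    invOneAddMul s hs x = (1 + s * invOneAdd x)⁻¹ := rfl

/-- Convergence of the integrals of one test function. -/
def IntegralTendsto (ν : ℕ → Measure ℝ) (ν' : Measure ℝ) (f : ℝ →ᵇ ℝ) : Prop :=
  Tendsto (fun n => ∫ t, f t ∂(ν n)) atTop (𝓝 (∫ t, f t ∂ν'))

section

variable {ν : ℕ → Measure ℝ} {ν' : Measure ℝ}

theorem IntegralTendsto.add (hν : ∀ᶠ n in atTop, IsProbabilityMeasure (ν n))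
    [IsProbabilityMeasure ν'] {f g : ℝ →ᵇ ℝ} (hf : IntegralTendsto ν ν' f)
    (hg : IntegralTendsto ν ν' g) : IntegralTendsto ν ν' (f + g) := by
  unfold IntegralTendsto at *
  have h := hf.add hg
  rw [← integral_add (f.integrable _) (g.integrable _)] at h
  refine h.congr' ?_
  filter_upwards [hν] with n hn
  rw [← integral_add (f.integrable _) (g.integrable _)]
  rfl

theorem IntegralTendsto.smul {f : ℝ →ᵇ ℝ} (hf : IntegralTendsto ν ν' f) (r : ℝ) :
    IntegralTendsto ν ν' (r • f) := by
  unfold IntegralTendsto at *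
  simpa [integral_const_mul] using hf.const_mul r

theorem IntegralTendsto.sub (hν : ∀ᶠ n in atTop, IsProbabilityMeasure (ν n))
    [IsProbabilityMeasure ν'] {f g : ℝ →ᵇ ℝ} (hf : IntegralTendsto ν ν' f)
    (hg : IntegralTendsto ν ν' g) : IntegralTendsto ν ν' (f - g) := by
  have h : f - g = f + (-1 : ℝ) • g := by ext x; simp [sub_eq_add_neg]
  exact h ▸ hf.add hν (hg.smul (-1))

theorem integralTendsto_one (hν : ∀ᶠ n in atTop, IsProbabilityMeasure (ν n))
    [IsProbabilityMeasure ν'] : IntegralTendsto ν ν' 1 := by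
  refine tendsto_const_nhds.congr' ?_
  filter_upwards [hν] with n hn
  simp

/-- Test functions may be replaced by approximations that are close in mean. -/
theorem integralTendsto_of_approx {f : ℝ →ᵇ ℝ}
    (h : ∀ ε > 0, ∃ g : ℝ →ᵇ ℝ, IntegralTendsto ν ν' g ∧
      (∀ᶠ n in atTop, |∫ t, f t ∂(ν n) - ∫ t, g t ∂(ν n)| ≤ ε) ∧
      |∫ t, f t ∂ν' - ∫ t, g t ∂ν'| ≤ ε) : IntegralTendsto ν ν' f := by
  refine Metric.tendsto_nhds.2 fun ε hε => ?_
  obtain ⟨g, hg, h1, h2⟩ := h (ε / 4) (by positivity)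
  filter_upwards [h1, Metric.tendsto_nhds.1 hg (ε / 4) (by positivity)] with n h1 h3
  rw [Real.dist_eq] at *
  rw [abs_le] at h1 h2
  rw [abs_lt] at h3 ⊢
  constructor <;> linarith

theorem abs_integral_sub_integral_le (μ : Measure ℝ) [IsProbabilityMeasure μ] (f g : ℝ →ᵇ ℝ)
    {ε : ℝ} (h : ∀ x, |f x - g x| ≤ ε) : |∫ t, f t ∂μ - ∫ t, g t ∂μ| ≤ ε := by
  rw [← integral_sub (f.integrable _) (g.integrable _)]
  have := norm_integral_le_of_norm_le_const (μ := μ) (f := fun t => f t - g t)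
    (C := ε) (Eventually.of_forall h)
  simpa using this

theorem integralTendsto_of_uniform_approx (hν : ∀ᶠ n in atTop, IsProbabilityMeasure (ν n))
    [IsProbabilityMeasure ν'] {f : ℝ →ᵇ ℝ}
    (h : ∀ ε > 0, ∃ g : ℝ →ᵇ ℝ, IntegralTendsto ν ν' g ∧ ∀ x, |f x - g x| ≤ ε) :
    IntegralTendsto ν ν' f := by
  refine integralTendsto_of_approx fun ε hε => ?_
  obtain ⟨g, hg, h1⟩ := h ε hε
  refine ⟨g, hg, ?_, abs_integral_sub_integral_le _ _ _ h1⟩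
  filter_upwards [hν] with n hn
  exact abs_integral_sub_integral_le _ _ _ h1

/-- With `u = invOneAdd` and `s = 1/(m+1)`, the function `u^(k+1)/(1+su)` tends to `u^(k+1)`
uniformly as `s → 0`, and `u^(k+2)/(1+su) = s⁻¹ (u^(k+1) - u^(k+1)/(1+su))`. Alternating the two
facts climbs through all powers. -/
theorem integralTendsto_pow_mul (hν : ∀ᶠ n in atTop, IsProbabilityMeasure (ν n))
    [IsProbabilityMeasure ν']
    (h : ∀ m : ℕ, IntegralTendsto ν ν'
      (invOneAdd * invOneAddMul ((m : ℝ) + 1)⁻¹ (by positivity))) (k : ℕ) :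
    IntegralTendsto ν ν' (invOneAdd ^ (k + 1)) ∧ ∀ m : ℕ, IntegralTendsto ν ν'
      (invOneAdd ^ (k + 1) * invOneAddMul ((m : ℝ) + 1)⁻¹ (by positivity)) := by
  have key : ∀ k : ℕ, (∀ m : ℕ, IntegralTendsto ν ν'
      (invOneAdd ^ (k + 1) * invOneAddMul ((m : ℝ) + 1)⁻¹ (by positivity))) →
      IntegralTendsto ν ν' (invOneAdd ^ (k + 1)) := by
    intro k hk
    refine integralTendsto_of_uniform_approx hν fun ε hε => ?_
    obtain ⟨m, hm⟩ := exists_nat_one_div_lt hε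
    refine ⟨_, hk m, fun x => ?_⟩
    have hu := invOneAdd_pos x
    have hu1 := invOneAdd_le_one x
    simp only [BoundedContinuousFunction.coe_mul, BoundedContinuousFunction.coe_pow,
      Pi.mul_apply, Pi.pow_apply, invOneAddMul_apply]
    rw [one_div] at hm
    have hs : (0 : ℝ) < ((m : ℝ) + 1)⁻¹ := by positivity
    set s := ((m : ℝ) + 1)⁻¹
    set u := invOneAdd x
    have hup : u ^ (k + 1) ≤ 1 := pow_le_one₀ hu.le hu1
    have h1 : u ^ (k + 1) - u ^ (k + 1) * (1 + s * u)⁻¹ = s * (u ^ (k + 1) * u * (1 + s * u)⁻¹) := by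
      field_simp; ring
    have h2 : (1 + s * u)⁻¹ ≤ 1 := inv_le_one_of_one_le₀ (by nlinarith)
    have h3 : u ^ (k + 1) * u * (1 + s * u)⁻¹ ≤ 1 := by
      have : u ^ (k + 1) * u ≤ 1 := mul_le_one₀ hup hu.le hu1
      exact mul_le_one₀ this (by positivity) h2
    rw [h1, abs_of_nonneg (by positivity)]
    nlinarith
  induction k with
  | zero =>
    have h0 : ∀ m : ℕ, IntegralTendsto ν ν'
      (invOneAdd ^ (0 + 1) * invOneAddMul ((m : ℝ) + 1)⁻¹ (by positivity)) := by simpa using h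
    exact ⟨key 0 h0, h0⟩
  | succ k ih =>
    have h0 : ∀ m : ℕ, IntegralTendsto ν ν'
      (invOneAdd ^ (k + 1 + 1) * invOneAddMul ((m : ℝ) + 1)⁻¹ (by positivity)) := by
      intro m
      have := (ih.1.sub hν (ih.2 m)).smul ((m : ℝ) + 1)
      convert this using 1
      ext x
      have hu := invOneAdd_pos x
      simp only [BoundedContinuousFunction.coe_mul, BoundedContinuousFunction.coe_pow,
        Pi.mul_apply, Pi.pow_apply, invOneAddMul_apply, BoundedContinuousFunction.coe_smul,
        BoundedContinuousFunction.coe_sub, Pi.sub_apply, smul_eq_mul]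
      field_simp
      ring
    exact ⟨key _ h0, h0⟩

theorem aeval_invOneAdd_apply (q : Polynomial ℝ) (x : ℝ) :
    (Polynomial.aeval invOneAdd q) x = q.eval (invOneAdd x) := by
  rw [Polynomial.aeval_eq_sum_range, Polynomial.eval_eq_sum_range]
  simp

theorem integralTendsto_polynomial (hν : ∀ᶠ n in atTop, IsProbabilityMeasure (ν n))
    [IsProbabilityMeasure ν']
    (h : ∀ k : ℕ, IntegralTendsto ν ν' (invOneAdd ^ (k + 1))) (q : Polynomial ℝ) :
    IntegralTendsto ν ν' (Polynomial.aeval invOneAdd q) := by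
  induction q using Polynomial.induction_on' with
  | add q r hq hr => rw [map_add]; exact hq.add hν hr
  | monomial k a =>
    rw [Polynomial.aeval_monomial, ← Algebra.smul_def]
    refine IntegralTendsto.smul ?_ a
    cases k with
    | zero => rw [pow_zero]; exact integralTendsto_one hν
    | succ k => exact h k

/-- Polynomials in `invOneAdd` being convergence tests, so is every continuous function of it. -/
theorem integralTendsto_comp (hν : ∀ᶠ n in atTop, IsProbabilityMeasure (ν n))
    [IsProbabilityMeasure ν']
    (h : ∀ q : Polynomial ℝ, IntegralTendsto ν ν' (Polynomial.aeval invOneAdd q))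
    (g : ℝ → ℝ) (hg : ContinuousOn g (Set.Icc 0 1)) (f : ℝ →ᵇ ℝ)
    (hf : ∀ x, f x = g (invOneAdd x)) : IntegralTendsto ν ν' f := by
  refine integralTendsto_of_uniform_approx hν fun ε hε => ?_
  obtain ⟨q, hq⟩ := exists_polynomial_near_of_continuousOn 0 1 g hg ε hε
  refine ⟨_, h q, fun x => ?_⟩
  rw [aeval_invOneAdd_apply, hf, abs_sub_comm]
  exact (hq _ ⟨(invOneAdd_pos x).le, invOneAdd_le_one x⟩).le

/-- The substitution `v = (1+x)⁻¹` sends `x = ∞` to `v = 0`, where `f` need not have a limit; the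
bounded `f` is multiplied by a factor vanishing there. -/
theorem continuousOn_cutoff (f : ℝ →ᵇ ℝ) (k : ℕ) :
    ContinuousOn (fun v => f (v⁻¹ - 1) * (1 - (1 - v) ^ k)) (Set.Icc 0 1) := by
  intro v hv
  rcases hv.1.eq_or_lt with h0 | h0
  · subst h0
    refine ContinuousAt.continuousWithinAt ?_
    have h1 : Tendsto (fun v : ℝ => 1 - (1 - v) ^ k) (𝓝 0) (𝓝 0) := by
      have : Continuous (fun v : ℝ => 1 - (1 - v) ^ k) := by fun_prop
      simpa using this.tendsto 0
    have := bdd_le_mul_tendsto_zero' (f := fun v : ℝ => f (v⁻¹ - 1)) ‖f‖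
      (Eventually.of_forall fun v => f.norm_coe_le_norm _) h1
    simpa [ContinuousAt] using this
  · refine ContinuousAt.continuousWithinAt ?_
    refine ContinuousAt.mul ?_ (by fun_prop)
    exact f.continuous.continuousAt.comp ((continuousAt_inv₀ h0.ne').sub continuousAt_const)

theorem tendsto_integral_one_sub_invOneAdd_pow [IsProbabilityMeasure ν'] :
    Tendsto (fun k : ℕ => ∫ x, (1 - invOneAdd x) ^ k ∂ν') atTop (𝓝 0) := by
  have : Tendsto (fun k : ℕ => ∫ x, (1 - invOneAdd x) ^ k ∂ν') atTop (𝓝 (∫ _x, (0:ℝ) ∂ν')) := by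
    refine tendsto_integral_of_dominated_convergence (fun _ => 1) ?_ (integrable_const _) ?_ ?_
    · intro k
      exact Continuous.aestronglyMeasurable (by fun_prop)
    · intro k
      refine Eventually.of_forall fun x => ?_
      have h1 := invOneAdd_pos x
      have h2 := invOneAdd_le_one x
      rw [norm_pow]
      refine pow_le_one₀ (norm_nonneg _) ?_
      rw [Real.norm_of_nonneg] <;> linarith
    · refine Eventually.of_forall fun x => ?_
      have h1 := invOneAdd_pos x
      have h2 := invOneAdd_le_one x
      exact tendsto_pow_atTop_nhds_zero_of_lt_one (by linarith) (by linarith)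
  simpa using this

/-- Probability measures on `[0, ∞)` converge weakly as soon as their Stieltjes transforms converge
at the points `-(1 + 1 / (m + 1))`. -/
theorem weaklyConverges_of_stieltjes (hν : ∀ᶠ n in atTop, IsProbabilityMeasure (ν n))
    [IsProbabilityMeasure ν'] (hν0 : ∀ᶠ n in atTop, ∀ᵐ x ∂(ν n), 0 ≤ x)
    (hν0' : ∀ᵐ x ∂ν', 0 ≤ x)
    (h : ∀ m : ℕ, Tendsto (fun n => ∫ x, (x + (1 + ((m : ℝ) + 1)⁻¹))⁻¹ ∂(ν n)) atTop
      (𝓝 (∫ x, (x + (1 + ((m : ℝ) + 1)⁻¹))⁻¹ ∂ν'))) : WeaklyConverges ν ν' := by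
  have hbase : ∀ m : ℕ, IntegralTendsto ν ν'
      (invOneAdd * invOneAddMul ((m : ℝ) + 1)⁻¹ (by positivity)) := by
    intro m
    -- On `[0, ∞)` the Stieltjes kernel is `u/(1+su)`, since `u⁻¹ + s = 1 + x + s`.
    have hpt : ∀ x : ℝ, 0 ≤ x → (x + (1 + ((m : ℝ) + 1)⁻¹))⁻¹ =
        (invOneAdd * invOneAddMul ((m : ℝ) + 1)⁻¹ (by positivity)) x := by
      intro x hx
      simp only [BoundedContinuousFunction.coe_mul, Pi.mul_apply, invOneAddMul_apply,
        invOneAdd_apply, abs_of_nonneg hx]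
      field_simp
      ring
    have := h m
    rw [integral_congr_ae (hν0'.mono hpt)] at this
    refine this.congr' ?_
    filter_upwards [hν0] with n hn
    exact integral_congr_ae (hn.mono hpt)
  have hpoly := integralTendsto_polynomial hν fun k => (integralTendsto_pow_mul hν hbase k).1
  intro f
  have hpow : ∀ k : ℕ, IntegralTendsto ν ν' ((1 - invOneAdd) ^ k) := by
    intro k
    have := hpoly ((1 - Polynomial.X) ^ k)
    simpa using this
  -- The cutoff error is bounded by the integral of a polynomial in `invOneAdd`, so its smallness
  -- passes from `ν'` to `ν n`: tightness comes for free. Composing `f` with `|x|` makes the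
  -- truncation a function of `invOneAdd` on all of `ℝ`.
  have hcut : ∀ (k : ℕ) (μ : Measure ℝ) [IsProbabilityMeasure μ], (∀ᵐ x ∂μ, 0 ≤ x) →
      |∫ t, f t ∂μ - ∫ t, (f.compContinuous ⟨fun x => |x|, by fun_prop⟩ *
        (1 - (1 - invOneAdd) ^ k)) t ∂μ| ≤ ‖f‖ * ∫ t, ((1 - invOneAdd) ^ k) t ∂μ := by
    intro k μ _ hμ
    rw [← integral_sub (f.integrable _) (BoundedContinuousFunction.integrable _ _),
      ← integral_const_mul, ← Real.norm_eq_abs]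
    refine norm_integral_le_of_norm_le ((BoundedContinuousFunction.integrable _ _).const_mul _) ?_
    filter_upwards [hμ] with x hx
    have h1 : 0 ≤ 1 - invOneAdd x := by linarith [invOneAdd_le_one x]
    simp only [BoundedContinuousFunction.coe_mul, Pi.mul_apply, BoundedContinuousFunction.coe_sub,
      Pi.sub_apply, BoundedContinuousFunction.coe_one, Pi.one_apply,
      BoundedContinuousFunction.coe_pow, Pi.pow_apply,
      BoundedContinuousFunction.compContinuous_apply, ContinuousMap.coe_mk, abs_of_nonneg hx]
    rw [show f x - f x * (1 - (1 - invOneAdd x) ^ k) = f x * (1 - invOneAdd x) ^ k by ring,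
      norm_mul, Real.norm_of_nonneg (pow_nonneg h1 k)]
    exact mul_le_mul_of_nonneg_right (f.norm_coe_le_norm x) (pow_nonneg h1 k)
  refine integralTendsto_of_approx fun ε hε => ?_
  have hsm : ∀ᶠ k : ℕ in atTop, ‖f‖ * ∫ x, (1 - invOneAdd x) ^ k ∂ν' < ε := by
    have := (tendsto_integral_one_sub_invOneAdd_pow (ν' := ν')).const_mul ‖f‖
    rw [mul_zero] at this
    exact this.eventually_lt_const hε
  obtain ⟨k, hk⟩ := hsm.exists
  refine ⟨_, ?_, ?_, (hcut k ν' hν0').trans hk.le⟩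
  · refine integralTendsto_comp hν hpoly _ (continuousOn_cutoff f k) _ fun x => ?_
    simp [invOneAdd_apply]
  · have := ((hpow k).const_mul ‖f‖).eventually_lt_const hk
    filter_upwards [hν, hν0, this] with n h1 h2 h3
    exact (hcut k (ν n) h2).trans h3.le

end

/-! ### The explicit integral behind the Marchenko–Pastur density -/

/-- A primitive of `y ↦ √((β - y) (y - α)) / y` on `(α, β)`. -/
noncomputable def semicirclePrimitive (α β y : ℝ) : ℝ :=
  √((β - y) * (y - α)) + (α + β) / 2 * Real.arcsin ((2 * y - α - β) / (β - α)) -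
    √(α * β) * Real.arcsin (((α + β) * y - 2 * α * β) / (y * (β - α)))

theorem hasDerivAt_arcsin_of_sq {f : ℝ → ℝ} {f' y r : ℝ} (hf : HasDerivAt f f' y) (hr : 0 < r)
    (h : 1 - f y ^ 2 = r ^ 2) : HasDerivAt (fun y => Real.arcsin (f y)) (f' / r) y := by
  have h1 : √(1 - f y ^ 2) = r := by rw [h, Real.sqrt_sq hr.le]
  have hlt : f y ^ 2 < 1 := by nlinarith [sq_pos_of_pos hr]
  have hab := abs_lt.1 ((sq_lt_one_iff_abs_lt_one _).1 hlt)
  have := (Real.hasDerivAt_arcsin hab.1.ne' hab.2.ne).comp y hf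
  rw [h1] at this
  exact this.congr_deriv (by ring)

theorem hasDerivAt_semicirclePrimitive {α β y : ℝ} (hα : 0 ≤ α) (hy : y ∈ Set.Ioo α β) :
    HasDerivAt (semicirclePrimitive α β) (√((β - y) * (y - α)) / y) y := by
  obtain ⟨h1, h2⟩ := hy
  have hy0 : 0 < y := hα.trans_lt h1
  have hβ : 0 < β := hy0.trans h2
  have hβα : 0 < β - α := by linarith
  have hR : 0 < (β - y) * (y - α) := mul_pos (by linarith) (by linarith)
  have hr : 0 < √((β - y) * (y - α)) := Real.sqrt_pos.2 hR
  have hr2 : √((β - y) * (y - α)) ^ 2 = (β - y) * (y - α) := Real.sq_sqrt hR.le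
  have d1 : HasDerivAt (fun y => √((β - y) * (y - α)))
      ((α + β - 2 * y) / (2 * √((β - y) * (y - α)))) y := by
    have : HasDerivAt (fun y => (β - y) * (y - α)) (α + β - 2 * y) y := by
      refine (((hasDerivAt_id y).const_sub β).mul ((hasDerivAt_id y).sub_const α)).congr_deriv ?_
      simp; ring
    exact this.sqrt hR.ne'
  have d2 : HasDerivAt (fun y => (α + β) / 2 * Real.arcsin ((2 * y - α - β) / (β - α)))
      ((α + β) / 2 * ((2 / (β - α)) / (2 * √((β - y) * (y - α)) / (β - α)))) y := by
    refine (hasDerivAt_arcsin_of_sq ?_ (by positivity) ?_).const_mul _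
    · exact (((((hasDerivAt_id y).const_mul 2).sub_const α).sub_const β).div_const
        (β - α)).congr_deriv (by simp)
    · rw [div_pow, div_pow, mul_pow, hr2]
      field_simp
      ring
  have d3 : HasDerivAt (fun y => √(α * β) *
      Real.arcsin (((α + β) * y - 2 * α * β) / (y * (β - α))))
      (α * β / (y * √((β - y) * (y - α)))) y := by
    -- For `α = 0` the coefficient `√(α * β)` kills this term.
    rcases hα.eq_or_lt with h0 | h0
    · subst h0
      simpa using hasDerivAt_const y (0 : ℝ)
    · have hs : 0 < √(α * β) := Real.sqrt_pos.2 (mul_pos h0 hβ)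
      have hs2 : √(α * β) ^ 2 = α * β := Real.sq_sqrt (mul_pos h0 hβ).le
      have := (hasDerivAt_arcsin_of_sq (y := y)
        (f := fun y => ((α + β) * y - 2 * α * β) / (y * (β - α)))
        (f' := 2 * α * β / (y ^ 2 * (β - α)))
        (r := 2 * √(α * β) * √((β - y) * (y - α)) / (y * (β - α))) ?_ (by positivity)
        ?_).const_mul √(α * β)
      · refine this.congr_deriv ?_
        field_simp
      · have hd : y * (β - α) ≠ 0 := by positivity
        refine ((((hasDerivAt_id y).const_mul (α + β)).sub_const (2 * α * β)).div
          ((hasDerivAt_id y).mul_const (β - α)) hd).congr_deriv ?_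
        simp
        field_simp
        ring
      · simp only [div_pow, mul_pow, hr2, hs2]
        field_simp
        ring
  -- Over the common denominator `y r`, with `r` the root, the numerators add up to `(α+β)y - y² -
  -- αβ = r²`.
  refine ((d1.add d2).sub d3).congr_deriv ?_
  set r := √((β - y) * (y - α))
  field_simp
  rw [hr2]
  ring

theorem continuousOn_semicirclePrimitive {α β : ℝ} (hα : 0 ≤ α) (hαβ : α < β) :
    ContinuousOn (semicirclePrimitive α β) (Set.Icc α β) := by
  have hβα : 0 < β - α := by linarith
  unfold semicirclePrimitive
  refine ContinuousOn.sub (Continuous.continuousOn ?_) ?_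
  · have := Real.continuous_arcsin
    fun_prop
  · rcases hα.eq_or_lt with h0 | h0
    · subst h0
      simpa using continuousOn_const
    · refine continuousOn_const.mul (Real.continuous_arcsin.comp_continuousOn ?_)
      refine ContinuousOn.div (by fun_prop) (by fun_prop) fun y hy => ?_
      have : 0 < y := h0.trans_le hy.1
      positivity

/-- For `α = 0` the integrand blows up at the left end; integrability holds because it is the
nonnegative derivative of a function continuous up to the ends. -/
theorem integrableOn_sqrt_div {α β : ℝ} (hα : 0 ≤ α) (hαβ : α < β) :
    IntegrableOn (fun y => √((β - y) * (y - α)) / y) (Set.Ioc α β) :=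
  intervalIntegral.integrableOn_deriv_of_nonneg (continuousOn_semicirclePrimitive hα hαβ)
    (fun _ hy => hasDerivAt_semicirclePrimitive hα hy)
    fun _ hy => div_nonneg (Real.sqrt_nonneg _) (hα.trans hy.1.le)

theorem integral_sqrt_div {α β : ℝ} (hα : 0 ≤ α) (hαβ : α < β) :
    ∫ y in α..β, √((β - y) * (y - α)) / y = Real.pi * ((α + β) / 2 - √(α * β)) := by
  rw [intervalIntegral.integral_eq_sub_of_hasDerivAt_of_le hαβ.le
    (continuousOn_semicirclePrimitive hα hαβ)
    (fun _ hy => hasDerivAt_semicirclePrimitive hα hy)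
    ((intervalIntegrable_iff_integrableOn_Ioc_of_le hαβ.le).2 (integrableOn_sqrt_div hα hαβ))]
  have hβα : β - α ≠ 0 := by linarith
  have hβ : β ≠ 0 := by linarith
  have e1 : (2 * β - α - β) / (β - α) = 1 := by field_simp; ring
  have e2 : (2 * α - α - β) / (β - α) = -1 := by field_simp; ring
  have e3 : ((α + β) * β - 2 * α * β) / (β * (β - α)) = 1 := by field_simp; ring
  rcases hα.eq_or_lt with h0 | h0
  · subst h0
    simp only [semicirclePrimitive, e1, e2]
    simp
    ring
  · have e4 : ((α + β) * α - 2 * α * β) / (α * (β - α)) = -1 := by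
      have := h0.ne'
      field_simp; ring
    simp only [semicirclePrimitive, e1, e2, e3, e4]
    simp
    ring

/-- Integrability on the support of the Marchenko–Pastur law. -/
theorem integrableOn_sqrt_div_add {a b t : ℝ} (ht : 0 ≤ a + t) (hab : a < b) :
    IntegrableOn (fun x => √((b - x) * (x - a)) / (x + t)) (Set.Icc a b) := by
  rw [integrableOn_Icc_iff_integrableOn_Ioc, ← intervalIntegrable_iff_integrableOn_Ioc_of_le hab.le]
  have := ((intervalIntegrable_iff_integrableOn_Ioc_of_le (by linarith)).2
    (integrableOn_sqrt_div ht (show a + t < b + t by linarith))).comp_add_right t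
  simpa using this

theorem integral_sqrt_div_add {a b t : ℝ} (ht : 0 ≤ a + t) (hab : a < b) :
    ∫ x in Set.Icc a b, √((b - x) * (x - a)) / (x + t) =
      Real.pi * ((a + b) / 2 + t - √((a + t) * (b + t))) := by
  rw [integral_Icc_eq_integral_Ioc, ← intervalIntegral.integral_of_le hab.le]
  have h := intervalIntegral.integral_comp_add_right (a := a) (b := b)
    (fun y => √((b + t - y) * (y - (a + t))) / y) t
  rw [integral_sqrt_div ht (by linarith)] at h
  simp only [add_sub_add_right_eq_sub] at h
  rw [h]
  ring

/-! ### Mass and Stieltjes transform of the Marchenko–Pastur law -/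

section MarchenkoPasturLaw

variable {c : ℝ}

theorem sqrt_edges_lt (hc : 0 < c) : (1 - √c) ^ 2 < (1 + √c) ^ 2 := by
  have := Real.sqrt_pos.2 hc
  nlinarith

theorem sqrt_edges_mul (hc : 0 < c) (t : ℝ) :
    ((1 - √c) ^ 2 + t) * ((1 + √c) ^ 2 + t) = (1 - c + t) ^ 2 + 4 * c * t := by
  have := Real.sq_sqrt hc.le
  linear_combination (2 * (t - 1) + (√c ^ 2 + c)) * this

theorem integrableOn_mpDensity_mul (hc : 0 < c) {t : ℝ} (ht : 0 ≤ t) :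
    IntegrableOn (fun x => √(((1 + √c) ^ 2 - x) * (x - (1 - √c) ^ 2)) / (2 * Real.pi * c * (x + t)))
      (Set.Icc ((1 - √c) ^ 2) ((1 + √c) ^ 2)) := by
  have := (integrableOn_sqrt_div_add (t := t) (by positivity) (sqrt_edges_lt hc)).div_const
    (2 * Real.pi * c)
  refine this.congr (Eventually.of_forall fun x => ?_)
  simp only
  rw [div_div, mul_comm (x + t)]

theorem integral_mpDensity_mul (hc : 0 < c) {t : ℝ} (ht : 0 ≤ t) :
    ∫ x in Set.Icc ((1 - √c) ^ 2) ((1 + √c) ^ 2),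
      √(((1 + √c) ^ 2 - x) * (x - (1 - √c) ^ 2)) / (2 * Real.pi * c * (x + t)) =
      (1 + c + t - √((1 - c + t) ^ 2 + 4 * c * t)) / (2 * c) := by
  have h := integral_sqrt_div_add (t := t) (by positivity) (sqrt_edges_lt hc)
  rw [sqrt_edges_mul hc] at h
  have h2 : ∀ x : ℝ, √(((1 + √c) ^ 2 - x) * (x - (1 - √c) ^ 2)) / (2 * Real.pi * c * (x + t)) =
      (2 * Real.pi * c)⁻¹ * (√(((1 + √c) ^ 2 - x) * (x - (1 - √c) ^ 2)) / (x + t)) := by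
    intro x
    rw [mul_comm (2 * Real.pi * c) (x + t), ← div_div, div_eq_inv_mul _ (2 * Real.pi * c)]
  simp_rw [h2]
  rw [integral_const_mul, h]
  have := Real.sq_sqrt hc.le
  have hpi := Real.pi_pos
  field_simp
  linear_combination 2 * this

theorem mpDensity_nonneg (hc : 0 < c) {x : ℝ}
    (hx : x ∈ Set.Icc ((1 - √c) ^ 2) ((1 + √c) ^ 2)) :
    0 ≤ √(((1 + √c) ^ 2 - x) * (x - (1 - √c) ^ 2)) / (2 * Real.pi * c * x) := by
  have : 0 ≤ x := (sq_nonneg _).trans hx.1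
  positivity

theorem max_one_sub_one_div (hc : 0 < c) :
    max (1 - 1 / c) 0 = (c - 1 + |1 - c|) / (2 * c) := by
  rcases le_total 1 c with h | h
  · rw [max_eq_left (by rw [sub_nonneg, div_le_one hc]; exact h), abs_of_nonpos (by linarith)]
    field_simp
    ring
  · rw [max_eq_right (by rw [sub_nonpos, one_le_div hc]; exact h), abs_of_nonneg (by linarith)]
    simp

/-- The density integrates to `(1 + c - |1-c|)/(2c)`, the case `t = 0` of `integral_mpDensity_mul`,
and the atom supplies the rest for `c ≤ 1` and `c ≥ 1` alike. -/
theorem isProbabilityMeasure_mpLaw (hc : 0 < c) : IsProbabilityMeasure (mpLaw c) := by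
  constructor
  have h0 := integrableOn_mpDensity_mul hc le_rfl
  have h1 := integral_mpDensity_mul hc le_rfl
  simp only [add_zero, mul_zero] at h0 h1
  rw [Real.sqrt_sq_eq_abs] at h1
  rw [mpLaw, Measure.add_apply, Measure.smul_apply, Measure.dirac_apply_of_mem (Set.mem_univ _),
    smul_eq_mul, mul_one, withDensity_apply _ MeasurableSet.univ, Measure.restrict_univ,
    ← ofReal_integral_eq_lintegral_ofReal h0
      (ae_restrict_of_forall_mem measurableSet_Icc fun x hx => mpDensity_nonneg hc hx), h1,
    ← ENNReal.ofReal_add (le_max_right _ _)]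
  · rw [max_one_sub_one_div hc, ENNReal.ofReal_eq_one]
    field_simp
    ring
  · refine div_nonneg ?_ (by positivity)
    rcases abs_cases (1 - c) with h | h <;> linarith

theorem ae_mpLaw_nonneg : ∀ᵐ x ∂(mpLaw c), 0 ≤ x := by
  rw [mpLaw, ae_add_measure_iff]
  constructor
  · refine Measure.ae_smul_measure ?_ _
    exact (ae_dirac_iff measurableSet_Ici).2 le_rfl
  · refine (withDensity_absolutelyContinuous _ _).ae_le ?_
    exact ae_restrict_of_forall_mem measurableSet_Icc fun x hx => (sq_nonneg _).trans hx.1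

/-- Partial fractions, `1/(x(x+t)) = t⁻¹ (1/x - 1/(x+t))`, reduce the density part to the values of
`integral_mpDensity_mul` at `0` and `t`. -/
theorem integral_mpLaw_inv_add (hc : 0 < c) {t : ℝ} (ht : 0 < t) :
    ∫ x, (x + t)⁻¹ ∂(mpLaw c) = (c - 1 - t + √((1 - c + t) ^ 2 + 4 * c * t)) / (2 * c * t) := by
  have h0 := integrableOn_mpDensity_mul hc le_rfl
  have h1 := integral_mpDensity_mul hc le_rfl
  have h2 := integrableOn_mpDensity_mul hc ht.le
  have h3 := integral_mpDensity_mul hc ht.le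
  simp only [add_zero, mul_zero] at h0 h1
  rw [Real.sqrt_sq_eq_abs] at h1
  have hprob := isProbabilityMeasure_mpLaw hc
  have hint : Integrable (fun x => (x + t)⁻¹) (mpLaw c) := by
    refine Integrable.mono' (integrable_const t⁻¹) (by fun_prop) ?_
    filter_upwards [ae_mpLaw_nonneg (c := c)] with x hx
    rw [Real.norm_of_nonneg (by positivity)]
    exact inv_anti₀ ht (by linarith)
  rw [mpLaw] at hint ⊢
  rw [integral_add_measure hint.left_of_add_measure hint.right_of_add_measure,
    integral_smul_measure, integral_dirac, zero_add,
    integral_withDensity_eq_integral_toReal_smul (by fun_prop) (by simp),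
    ENNReal.toReal_ofReal (le_max_right _ _), max_one_sub_one_div hc]
  have h4 : ∫ x in Set.Icc ((1 - √c) ^ 2) ((1 + √c) ^ 2),
      (ENNReal.ofReal (√(((1 + √c) ^ 2 - x) * (x - (1 - √c) ^ 2)) /
        (2 * Real.pi * c * x))).toReal • (x + t)⁻¹ = t⁻¹ *
      ((1 + c - |1 - c|) / (2 * c) - (1 + c + t - √((1 - c + t) ^ 2 + 4 * c * t)) / (2 * c)) := by
    rw [← h1, ← h3, ← integral_sub h0 h2, ← integral_const_mul]
    refine integral_congr_ae ((ae_restrict_mem measurableSet_Icc).mono fun x hx => ?_)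
    have hx0 : 0 ≤ x := (sq_nonneg _).trans hx.1
    simp only
    rw [ENNReal.toReal_ofReal (mpDensity_nonneg hc hx), smul_eq_mul]
    -- The point `x = 0` lies in the support only if the left edge is `0`, and then the root
    -- vanishes.
    rcases hx0.eq_or_lt with h | h
    · have hz : √(((1 + √c) ^ 2 - x) * (x - (1 - √c) ^ 2)) = 0 := by
        refine Real.sqrt_eq_zero_of_nonpos ?_
        have := hx.1
        rw [← h] at this ⊢
        nlinarith [sq_nonneg (1 + √c), sq_nonneg (1 - √c)]
      simp [hz]
    · have := Real.pi_pos
      field_simp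
      ring
  rw [h4, smul_eq_mul]
  field_simp
  ring

theorem integral_mpLaw_inv_add_nonneg {t : ℝ} (ht : 0 < t) :
    0 ≤ ∫ x, (x + t)⁻¹ ∂(mpLaw c) := by
  refine integral_nonneg_of_ae (ae_mpLaw_nonneg.mono fun x hx => ?_)
  simp only [Pi.zero_apply]
  positivity

/-- The fixed point equation for the Stieltjes transform of the Marchenko–Pastur law. -/
theorem integral_mpLaw_inv_add_eq (hc : 0 < c) {t : ℝ} (ht : 0 < t) :
    t * (∫ x, (x + t)⁻¹ ∂(mpLaw c)) +
      (∫ x, (x + t)⁻¹ ∂(mpLaw c)) / (1 + c * ∫ x, (x + t)⁻¹ ∂(mpLaw c)) = 1 := by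
  have hs := integral_mpLaw_inv_add_nonneg (c := c) ht
  have h := integral_mpLaw_inv_add hc ht
  set s := ∫ x, (x + t)⁻¹ ∂(mpLaw c)
  have hD := Real.sq_sqrt (show 0 ≤ (1 - c + t) ^ 2 + 4 * c * t by positivity)
  rw [eq_div_iff (by positivity)] at h
  have hr : √((1 - c + t) ^ 2 + 4 * c * t) = s * (2 * c * t) - (c - 1 - t) := by linarith
  rw [hr] at hD
  -- Squaring away the root leaves the quadratic obtained by clearing denominators in the fixed
  -- point equation.
  have hq : c * t * (c * t * s ^ 2 + (1 - c + t) * s - 1) = 0 := by linarith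
  have hq2 := (mul_eq_zero.1 hq).resolve_left (by positivity)
  have : 1 + c * s ≠ 0 := by positivity
  field_simp
  linarith

end MarchenkoPasturLaw

/-! ### Removing one column -/

section ShiftedGram

variable {ι : Type*} [DecidableEq ι]

/-- The matrix `t + a ∑ₖ Yₖ Yₖᵀ`. -/
def shiftedGram {κ : Type*} [Fintype κ] (t a : ℝ) (Y : κ → ι → ℝ) : Matrix ι ι ℝ :=
  t • 1 + a • ∑ k, Matrix.vecMulVec (Y k) (Y k)

/-- The scale `a` is independent of the number of columns, so it stays `n⁻¹` after a column is
removed. -/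
theorem shiftedGram_eq_removeNth {n : ℕ} (t a : ℝ) (Y : Fin (n + 1) → ι → ℝ) (k : Fin (n + 1)) :
    shiftedGram t a Y =
      shiftedGram t a (k.removeNth Y) + a • Matrix.vecMulVec (Y k) (Y k) := by
  rw [shiftedGram, shiftedGram, Fin.sum_univ_succAbove _ k, smul_add, add_comm (a • _),
    add_assoc]
  rfl

end ShiftedGram

/-! ### Resolvent bounds and rank-one perturbations -/

section Resolvent

variable {ι : Type*} [Fintype ι] {t : ℝ}

/-- The matrix `A` is symmetric and bounded below by `t`. -/
def BoundedBelow (t : ℝ) (A : Matrix ι ι ℝ) : Prop :=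
  A.IsSymm ∧ ∀ w : ι → ℝ, t * (w ⬝ᵥ w) ≤ w ⬝ᵥ A *ᵥ w

theorem dotProduct_self_nonneg (w : ι → ℝ) : 0 ≤ w ⬝ᵥ w :=
  Finset.sum_nonneg fun i _ => mul_self_nonneg (w i)

theorem dotProduct_vecMulVec_mulVec (u v w : ι → ℝ) :
    u ⬝ᵥ Matrix.vecMulVec v v *ᵥ w = (u ⬝ᵥ v) * (v ⬝ᵥ w) := by
  rw [Matrix.vecMulVec_mulVec, dotProduct_smul]
  simp

theorem BoundedBelow.add_vecMulVec {A : Matrix ι ι ℝ} (hA : BoundedBelow t A) {a : ℝ}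
    (ha : 0 ≤ a) (v : ι → ℝ) : BoundedBelow t (A + a • Matrix.vecMulVec v v) := by
  refine ⟨?_, fun w => ?_⟩
  · refine hA.1.add (Matrix.IsSymm.smul ?_ a)
    exact Matrix.IsSymm.ext fun i j => by simp [Matrix.vecMulVec_apply, mul_comm]
  · rw [Matrix.add_mulVec, dotProduct_add, Matrix.smul_mulVec, dotProduct_smul,
      dotProduct_vecMulVec_mulVec, dotProduct_comm v w, smul_eq_mul]
    have := hA.2 w
    have := mul_nonneg ha (mul_self_nonneg (w ⬝ᵥ v))
    linarith

variable [DecidableEq ι]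

theorem boundedBelow_smul_one (t : ℝ) : BoundedBelow t (t • (1 : Matrix ι ι ℝ)) := by
  refine ⟨Matrix.isSymm_one.smul t, fun w => ?_⟩
  simp [Matrix.smul_mulVec]

variable {A : Matrix ι ι ℝ}

theorem BoundedBelow.isUnit_det (ht : 0 < t) (hA : BoundedBelow t A) : IsUnit A.det := by
  rw [isUnit_iff_ne_zero]
  intro h
  obtain ⟨v, hv, h0⟩ := Matrix.exists_mulVec_eq_zero_iff.2 h
  have h1 := hA.2 v
  rw [h0, dotProduct_zero] at h1
  refine hv (dotProduct_self_eq_zero.1 (le_antisymm ?_ (dotProduct_self_nonneg v)))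
  exact nonpos_of_mul_nonpos_right h1 ht

theorem BoundedBelow.mulVec_inv_mulVec (ht : 0 < t) (hA : BoundedBelow t A) (v : ι → ℝ) :
    A *ᵥ (A⁻¹ *ᵥ v) = v := by
  rw [Matrix.mulVec_mulVec, Matrix.mul_nonsing_inv _ (hA.isUnit_det ht), Matrix.one_mulVec]

theorem BoundedBelow.inv_isSymm (hA : BoundedBelow t A) : A⁻¹.IsSymm := by
  rw [Matrix.IsSymm, Matrix.transpose_nonsing_inv, hA.1]

theorem BoundedBelow.mul_inv_mulVec_dotProduct_le (ht : 0 < t) (hA : BoundedBelow t A)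
    (v : ι → ℝ) : t * ((A⁻¹ *ᵥ v) ⬝ᵥ (A⁻¹ *ᵥ v)) ≤ v ⬝ᵥ A⁻¹ *ᵥ v := by
  have := hA.2 (A⁻¹ *ᵥ v)
  rwa [hA.mulVec_inv_mulVec ht, dotProduct_comm _ v] at this

theorem BoundedBelow.dotProduct_inv_nonneg (ht : 0 < t) (hA : BoundedBelow t A)
    (v : ι → ℝ) : 0 ≤ v ⬝ᵥ A⁻¹ *ᵥ v :=
  (mul_nonneg ht.le (dotProduct_self_nonneg _)).trans (hA.mul_inv_mulVec_dotProduct_le ht v)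

/-- Expand `‖v - t A⁻¹v‖² ≥ 0` and insert `t ‖A⁻¹v‖² ≤ vᵀA⁻¹v`; no diagonalization is needed. -/
theorem BoundedBelow.inv_mulVec_dotProduct_le (ht : 0 < t) (hA : BoundedBelow t A)
    (v : ι → ℝ) : (A⁻¹ *ᵥ v) ⬝ᵥ (A⁻¹ *ᵥ v) ≤ (1 / t) ^ 2 * (v ⬝ᵥ v) := by
  have h1 := hA.mul_inv_mulVec_dotProduct_le ht v
  have h2 := dotProduct_self_nonneg (v - t • (A⁻¹ *ᵥ v))
  have h3 : (v - t • (A⁻¹ *ᵥ v)) ⬝ᵥ (v - t • (A⁻¹ *ᵥ v)) =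
      v ⬝ᵥ v - 2 * t * (v ⬝ᵥ A⁻¹ *ᵥ v) + t ^ 2 * ((A⁻¹ *ᵥ v) ⬝ᵥ (A⁻¹ *ᵥ v)) := by
    rw [sub_dotProduct, dotProduct_sub, dotProduct_sub, smul_dotProduct, smul_dotProduct,
      dotProduct_smul, dotProduct_comm (A⁻¹ *ᵥ v) v]
    simp only [smul_eq_mul, dotProduct_smul]
    ring
  rw [div_pow, one_pow, one_div, inv_mul_eq_div, le_div_iff₀ (by positivity)]
  nlinarith

theorem BoundedBelow.inv_apply_mem_Icc (ht : 0 < t) (hA : BoundedBelow t A) (i : ι) :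
    A⁻¹ i i ∈ Set.Icc 0 (1 / t) := by
  have h1 := hA.mul_inv_mulVec_dotProduct_le ht (Pi.single i 1)
  have h0 : (Pi.single i 1 : ι → ℝ) ⬝ᵥ A⁻¹ *ᵥ Pi.single i 1 = A⁻¹ i i := by simp
  have h2 : A⁻¹ i i * A⁻¹ i i ≤ (A⁻¹ *ᵥ Pi.single i 1) ⬝ᵥ (A⁻¹ *ᵥ Pi.single i 1) := by
    have := Finset.single_le_sum
      (f := fun j => (A⁻¹ *ᵥ Pi.single i 1) j * (A⁻¹ *ᵥ Pi.single i 1) j)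
      (fun j _ => mul_self_nonneg _) (Finset.mem_univ i)
    simpa [dotProduct] using this
  have h3 : 0 ≤ A⁻¹ i i := h0 ▸ hA.dotProduct_inv_nonneg ht (Pi.single i 1)
  rw [h0] at h1
  refine ⟨h3, ?_⟩
  rw [le_div_iff₀ ht]
  by_contra! h
  have h4 : 0 < A⁻¹ i i := by
    rcases h3.eq_or_lt with h5 | h5
    · rw [← h5] at h; linarith
    · exact h5
  nlinarith

theorem BoundedBelow.trace_inv_mem_Icc (ht : 0 < t) (hA : BoundedBelow t A) :
    A⁻¹.trace ∈ Set.Icc 0 (Fintype.card ι / t) := by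
  refine ⟨Finset.sum_nonneg fun i _ => (hA.inv_apply_mem_Icc ht i).1, ?_⟩
  refine (Finset.sum_le_card_nsmul _ _ (1 / t) fun i _ => (hA.inv_apply_mem_Icc ht i).2).trans ?_
  simp [div_eq_mul_inv]

/-- The Sherman–Morrison formula. -/
theorem BoundedBelow.inv_add_vecMulVec (ht : 0 < t) (hA : BoundedBelow t A) {a : ℝ}
    (ha : 0 ≤ a) (v : ι → ℝ) :
    (A + a • Matrix.vecMulVec v v)⁻¹ = A⁻¹ - (a / (1 + a * (v ⬝ᵥ A⁻¹ *ᵥ v))) •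
      Matrix.vecMulVec (A⁻¹ *ᵥ v) (A⁻¹ *ᵥ v) := by
  refine Matrix.inv_eq_right_inv ?_
  have hq := mul_nonneg ha (hA.dotProduct_inv_nonneg ht v)
  have h1 : v ᵥ* A⁻¹ = A⁻¹ *ᵥ v := by
    conv_lhs => rw [← hA.inv_isSymm]
    rw [Matrix.vecMul_transpose]
  rw [mul_sub, add_mul, Matrix.mul_nonsing_inv _ (hA.isUnit_det ht), mul_smul_comm, add_mul,
    smul_mul_assoc, smul_mul_assoc, Matrix.vecMulVec_mul, h1, Matrix.mul_vecMulVec,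
    hA.mulVec_inv_mulVec ht, Matrix.mul_vecMulVec, Matrix.vecMulVec_mulVec]
  ext i j
  simp only [Matrix.sub_apply, Matrix.add_apply, Matrix.smul_apply, Matrix.vecMulVec_apply,
    Pi.smul_apply, smul_eq_mul, MulOpposite.smul_eq_mul_unop, MulOpposite.unop_op]
  field_simp
  ring

/-- This trades the full resolvent, which depends on the column `v`, for the one without `v`. -/
theorem BoundedBelow.dotProduct_inv_add_vecMulVec (ht : 0 < t) (hA : BoundedBelow t A) {a : ℝ}
    (ha : 0 ≤ a) (v : ι → ℝ) :
    v ⬝ᵥ (A + a • Matrix.vecMulVec v v)⁻¹ *ᵥ v =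
      (v ⬝ᵥ A⁻¹ *ᵥ v) / (1 + a * (v ⬝ᵥ A⁻¹ *ᵥ v)) := by
  have hq := mul_nonneg ha (hA.dotProduct_inv_nonneg ht v)
  rw [hA.inv_add_vecMulVec ht ha, Matrix.sub_mulVec, dotProduct_sub, Matrix.smul_mulVec,
    dotProduct_smul, dotProduct_vecMulVec_mulVec, dotProduct_comm (A⁻¹ *ᵥ v) v, smul_eq_mul]
  set q := v ⬝ᵥ A⁻¹ *ᵥ v
  have h1 : 1 + a * q ≠ 0 := by positivity
  have h2 : a / (1 + a * q) * (q * q) * (1 + a * q) = a * (q * q) := by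
    rw [mul_right_comm, div_mul_cancel₀ _ h1]
  rw [eq_div_iff h1]
  linear_combination -h2

/-- By Sherman–Morrison the difference is `a‖A⁻¹v‖²/(1 + a vᵀA⁻¹v)`, and `t‖A⁻¹v‖² ≤ vᵀA⁻¹v`. The
bound depends on neither `v` nor the dimension. -/
theorem BoundedBelow.trace_inv_sub_mem_Icc (ht : 0 < t) (hA : BoundedBelow t A) {a : ℝ}
    (ha : 0 ≤ a) (v : ι → ℝ) :
    A⁻¹.trace - (A + a • Matrix.vecMulVec v v)⁻¹.trace ∈ Set.Icc 0 (1 / t) := by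
  have h0 := hA.dotProduct_inv_nonneg ht v
  have hq := mul_nonneg ha h0
  have h1 := hA.mul_inv_mulVec_dotProduct_le ht v
  have h2 := dotProduct_self_nonneg (A⁻¹ *ᵥ v)
  rw [hA.inv_add_vecMulVec ht ha, Matrix.trace_sub, Matrix.trace_smul, Matrix.trace_vecMulVec,
    sub_sub_cancel, smul_eq_mul]
  refine ⟨by positivity, ?_⟩
  rw [div_mul_eq_mul_div, div_le_div_iff₀ (by positivity) ht]
  nlinarith

theorem quadForm_map_ofReal {p : ℕ} (B : Matrix (Fin p) (Fin p) ℝ) (v : Fin p → ℝ) :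
    quadForm (B.map (fun r : ℝ => (r : ℂ))) v = ((v ⬝ᵥ B *ᵥ v : ℝ) : ℂ) := by
  simp [quadForm, dotProduct, Matrix.mulVec]

/-- A real matrix acts separately on real and imaginary parts, so the real estimate applies to each.
-/
theorem BoundedBelow.matSpectralNorm_inv_le {p : ℕ} {A : Matrix (Fin p) (Fin p) ℝ} (ht : 0 < t)
    (hA : BoundedBelow t A) : matSpectralNorm (A⁻¹.map (fun r : ℝ => (r : ℂ))) ≤ 1 / t := by
  refine ContinuousLinearMap.opNorm_le_bound _ (by positivity) fun z => ?_
  refine le_of_sq_le_sq ?_ (by positivity)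
  rw [mul_pow, EuclideanSpace.norm_sq_eq, EuclideanSpace.norm_sq_eq, Matrix.ofLp_toEuclideanCLM]
  have hsplit : ∀ w : Fin p → ℂ, ∑ i, ‖w i‖ ^ 2 =
      (fun i => (w i).re) ⬝ᵥ (fun i => (w i).re) + (fun i => (w i).im) ⬝ᵥ (fun i => (w i).im) := by
    intro w
    rw [dotProduct, dotProduct, ← Finset.sum_add_distrib]
    exact Finset.sum_congr rfl fun i _ => by rw [Complex.sq_norm, Complex.normSq_apply]
  have hre : (fun i => ((A⁻¹.map (fun r : ℝ => (r : ℂ)) *ᵥ z.ofLp) i).re) =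
      A⁻¹ *ᵥ fun i => (z.ofLp i).re := by
    ext i
    simp [Matrix.mulVec, dotProduct]
  have him : (fun i => ((A⁻¹.map (fun r : ℝ => (r : ℂ)) *ᵥ z.ofLp) i).im) =
      A⁻¹ *ᵥ fun i => (z.ofLp i).im := by
    ext i
    simp [Matrix.mulVec, dotProduct]
  rw [hsplit, hsplit, hre, him, mul_add]
  exact add_le_add (hA.inv_mulVec_dotProduct_le ht _) (hA.inv_mulVec_dotProduct_le ht _)

theorem boundedBelow_shiftedGram {κ : Type*} [Fintype κ] {a : ℝ} (ha : 0 ≤ a) (Y : κ → ι → ℝ) :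
    BoundedBelow t (shiftedGram t a Y) := by
  classical
  rw [shiftedGram]
  refine Finset.induction_on (Finset.univ : Finset κ) ?_ fun k s hk ih => ?_
  · simpa using boundedBelow_smul_one t
  · rw [Finset.sum_insert hk, smul_add, add_comm (a • _), ← add_assoc]
    exact ih.add_vecMulVec ha _

/-- Take the trace of `M⁻¹M = 1`, expand the second factor into its rank-one terms, and apply the
rank-one formula to each. -/
theorem trace_shiftedGram_inv {n : ℕ} (ht : 0 < t) {a : ℝ} (ha : 0 ≤ a)
    (Y : Fin (n + 1) → ι → ℝ) :
    t * (shiftedGram t a Y)⁻¹.trace + ∑ k, a * (Y k ⬝ᵥ (shiftedGram t a (k.removeNth Y))⁻¹ *ᵥ Y k) /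
      (1 + a * (Y k ⬝ᵥ (shiftedGram t a (k.removeNth Y))⁻¹ *ᵥ Y k)) = Fintype.card ι := by
  have h1 : ((shiftedGram t a Y)⁻¹ * shiftedGram t a Y).trace = Fintype.card ι := by
    rw [Matrix.nonsing_inv_mul _ ((boundedBelow_shiftedGram ha Y).isUnit_det ht), Matrix.trace_one]
  rw [← h1]
  nth_rw 3 [shiftedGram]
  rw [mul_add, mul_smul_comm, mul_smul_comm, Finset.mul_sum, Matrix.trace_add, Matrix.trace_smul,
    Matrix.trace_smul, Matrix.trace_sum, mul_one, smul_eq_mul, smul_eq_mul, Finset.mul_sum]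
  congr 1
  refine Finset.sum_congr rfl fun k _ => ?_
  rw [Matrix.mul_vecMulVec, Matrix.trace_vecMulVec,
    dotProduct_comm ((shiftedGram t a Y)⁻¹ *ᵥ Y k),
    shiftedGram_eq_removeNth t a Y k,
    (boundedBelow_shiftedGram ha _).dotProduct_inv_add_vecMulVec ht ha, mul_div_assoc]

theorem continuous_shiftedGram_inv {κ : Type*} [Fintype κ] (ht : 0 < t) {a : ℝ}
    (ha : 0 ≤ a) : Continuous fun Y : κ → ι → ℝ => (shiftedGram t a Y)⁻¹ := by
  have h : Continuous fun Y : κ → ι → ℝ => shiftedGram t a Y := by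
    unfold shiftedGram
    fun_prop
  simp only [Matrix.inv_def, Ring.inverse_eq_inv']
  exact (h.matrix_det.inv₀ fun Y =>
    ((boundedBelow_shiftedGram ha Y).isUnit_det ht).ne_zero).smul h.matrix_adjugate

end Resolvent

/-! ### The empirical spectral distribution and its Stieltjes transform -/

section EmpiricalSpectralDistribution

variable {p : ℕ} {A : Matrix (Fin p) (Fin p) ℝ}

theorem isProbabilityMeasure_esd (hp : p ≠ 0) (hA : A.IsHermitian) :
    IsProbabilityMeasure (esd hA) := by
  constructor
  simp [esd, ENNReal.inv_mul_cancel, hp]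

theorem ae_esd_nonneg (hA : A.PosSemidef) : ∀ᵐ x ∂(esd hA.isHermitian), 0 ≤ x := by
  refine Measure.ae_smul_measure ?_ _
  rw [← Measure.sum_fintype, Measure.ae_sum_iff]
  exact fun i => (ae_dirac_iff measurableSet_Ici).2 (hA.eigenvalues_nonneg i)

theorem trace_inv_add_smul_one (hA : A.IsHermitian) {t : ℝ}
    (h : ∀ i, hA.eigenvalues i + t ≠ 0) :
    (A + t • 1)⁻¹.trace = ∑ i, (hA.eigenvalues i + t)⁻¹ := by
  set U := hA.eigenvectorUnitary
  have hU : (star U : Matrix (Fin p) (Fin p) ℝ) * U = 1 := Unitary.coe_star_mul_self U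
  have hU' : (U : Matrix (Fin p) (Fin p) ℝ) * star (U : Matrix (Fin p) (Fin p) ℝ) = 1 :=
    Unitary.coe_mul_star_self U
  have h1 : A + t • 1 = U * Matrix.diagonal (fun i => hA.eigenvalues i + t) *
      star (U : Matrix (Fin p) (Fin p) ℝ) := by
    have h2 : Matrix.diagonal (fun i => hA.eigenvalues i + t) =
        Matrix.diagonal (RCLike.ofReal ∘ hA.eigenvalues) + t • 1 := by
      rw [← Matrix.diagonal_one, ← Matrix.diagonal_smul, Matrix.diagonal_add]
      congr
      ext i
      simp
    have h3 := hA.spectral_theorem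
    rw [Unitary.conjStarAlgAut_apply] at h3
    rw [h2, mul_add, add_mul, ← h3, mul_smul_comm, mul_one, smul_mul_assoc, hU']
  have h4 : (A + t • 1)⁻¹ = U * Matrix.diagonal (fun i => (hA.eigenvalues i + t)⁻¹) *
      star (U : Matrix (Fin p) (Fin p) ℝ) := by
    refine Matrix.inv_eq_right_inv ?_
    rw [h1]
    calc _ = U * (Matrix.diagonal (fun i => hA.eigenvalues i + t) *
          ((star (U : Matrix (Fin p) (Fin p) ℝ) * U) *
            Matrix.diagonal (fun i => (hA.eigenvalues i + t)⁻¹))) *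
          star (U : Matrix (Fin p) (Fin p) ℝ) := by simp only [mul_assoc]
      _ = 1 := by
        rw [hU, one_mul, Matrix.diagonal_mul_diagonal]
        simp only [mul_inv_cancel₀ (h _), Matrix.diagonal_one, mul_one, hU']
  rw [h4, Matrix.trace_mul_comm, ← mul_assoc, hU, one_mul, Matrix.trace_diagonal]

theorem integral_esd_inv_add (hA : A.PosSemidef) {t : ℝ} (ht : 0 < t) :
    ∫ x, (x + t)⁻¹ ∂(esd hA.isHermitian) = (p : ℝ)⁻¹ * (A + t • 1)⁻¹.trace := by
  rw [trace_inv_add_smul_one hA.isHermitian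
    fun i => (add_pos_of_nonneg_of_pos (hA.eigenvalues_nonneg i) ht).ne', esd,
    integral_smul_measure, integral_finsetSum_measure fun i _ => integrable_dirac (by simp)]
  simp

theorem posSemidef_sampleCov {n : ℕ} (X : Matrix (Fin p) (Fin n) ℝ) :
    (sampleCov X).PosSemidef := by
  rw [sampleCov, ← Matrix.conjTranspose_eq_transpose_of_trivial]
  exact (Matrix.posSemidef_self_mul_conjTranspose X).smul (by positivity)

theorem sampleCov_add_smul_one {n : ℕ} (X : Matrix (Fin p) (Fin n) ℝ) (t : ℝ) :
    sampleCov X + t • 1 = shiftedGram t (n : ℝ)⁻¹ fun k => X.col k := by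
  rw [sampleCov, shiftedGram, add_comm]
  congr 2
  ext i j
  simp [Matrix.mul_apply, Matrix.sum_apply, Matrix.vecMulVec_apply]

end EmpiricalSpectralDistribution

/-! ### Concentration for functions of independent columns -/

section BoundedDifferences

variable {E : Type*} [MeasurableSpace E] (ν : Measure E) [IsProbabilityMeasure ν]

theorem measurePreserving_insertNth {n : ℕ} (k : Fin (n + 1)) :
    MeasurePreserving (fun z : E × (Fin n → E) => (k.insertNth z.1 z.2 : Fin (n + 1) → E))
      (ν.prod (Measure.pi fun _ => ν)) (Measure.pi fun _ => ν) :=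
  (measurePreserving_piFinSuccAbove (fun _ : Fin (n + 1) => ν) k).symm

theorem integrable_of_abs_le {α : Type*} [MeasurableSpace α] {μ : Measure α} [IsFiniteMeasure μ]
    {f : α → ℝ} (hf : Measurable f) {C : ℝ} (h : ∀ x, |f x| ≤ C) : Integrable f μ :=
  Integrable.of_bound hf.aestronglyMeasurable C (Eventually.of_forall h)

/-- Averaging out the first coordinate gives `g`, which inherits the bounded differences. For fixed
remaining coordinates, `f - g` is centred with values in `[-d, d]`, so Hoeffding's lemma contributes
a factor `exp(d²l²/2)`; induction handles `g`. -/
theorem integral_exp_sub_integral_le {d : ℝ} {n : ℕ} {f : (Fin n → E) → ℝ} (hf : Measurable f)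
    {C : ℝ} (hC : ∀ Y, |f Y| ≤ C) (hd : ∀ Y k y, |f (Function.update Y k y) - f Y| ≤ d) (l : ℝ) :
    ∫ Y, Real.exp (l * (f Y - ∫ Z, f Z ∂(Measure.pi fun _ => ν))) ∂(Measure.pi fun _ => ν) ≤
      Real.exp (n * d ^ 2 * l ^ 2 / 2) := by
  induction n with
  | zero =>
    have : ∀ Y, f Y = f Fin.elim0 := fun Y => congrArg f (Subsingleton.elim _ _)
    simp [this]
  | succ n ih =>
    set π : Measure (Fin n → E) := Measure.pi fun _ => ν
    have hmp := measurePreserving_insertNth ν (0 : Fin (n + 1))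
    have hcons : Measurable fun z : E × (Fin n → E) => f ((0 : Fin (n + 1)).insertNth z.1 z.2) :=
      hf.comp hmp.measurable
    set F : E → (Fin n → E) → ℝ := fun y Z => f ((0 : Fin (n + 1)).insertNth y Z) with hF
    set g : (Fin n → E) → ℝ := fun Z => ∫ y, F y Z ∂ν with hg
    have hgm : Measurable g := by
      have : StronglyMeasurable (Function.uncurry F) := hcons.stronglyMeasurable
      exact this.integral_prod_left.measurable
    have hFm : ∀ Z, Measurable fun y => F y Z := fun Z =>
      hcons.comp (measurable_id.prodMk measurable_const)
    have hFi : ∀ Z, Integrable (fun y => F y Z) ν := fun Z =>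
      integrable_of_abs_le (hFm Z) fun y => hC _
    have hgC : ∀ Z, |g Z| ≤ C := fun Z => by
      have := norm_integral_le_of_norm_le_const (μ := ν) (f := fun y => F y Z)
        (Eventually.of_forall fun y => hC _)
      simpa using this
    have hgd : ∀ Z k z, |g (Function.update Z k z) - g Z| ≤ d := fun Z k z => by
      rw [hg]
      simp only
      rw [← integral_sub (hFi _) (hFi _)]
      have := norm_integral_le_of_norm_le_const (μ := ν)
        (f := fun y => F y (Function.update Z k z) - F y Z) (C := d)
        (Eventually.of_forall fun y => by
          have := hd (Fin.cons y Z) k.succ z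
          rw [← Fin.cons_update] at this
          simpa [hF] using this)
      simpa using this
    have hint : ∫ Y, f Y ∂(Measure.pi fun _ => ν) = ∫ Z, g Z ∂π := by
      rw [← hmp.map_eq, integral_map hmp.measurable.aemeasurable hf.aestronglyMeasurable,
        integral_prod_symm _ (integrable_of_abs_le hcons fun z => hC _)]
    have hinner : ∀ Z, ∫ y, Real.exp (l * (F y Z - g Z)) ∂ν ≤ Real.exp (d ^ 2 * l ^ 2 / 2) := by
      intro Z
      have hb : ∀ y, F y Z - g Z ∈ Set.Icc (-d) d := fun y => by
        rw [Set.mem_Icc, ← abs_le]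
        have h1 : F y Z - g Z = ∫ y', (F y Z - F y' Z) ∂ν := by
          rw [integral_sub (integrable_const _) (hFi Z)]
          simp [hg]
        rw [h1]
        have := norm_integral_le_of_norm_le_const (μ := ν)
          (f := fun y' => F y Z - F y' Z) (C := d)
          (Eventually.of_forall fun y' => by
            have := hd (Fin.cons y' Z) 0 y
            rw [Fin.update_cons_zero] at this
            simpa [hF] using this)
        simpa using this
      have h0 : ∫ y, (F y Z - g Z) ∂ν = 0 := by
        rw [integral_sub (hFi Z) (integrable_const _)]
        simp [hg]
      have := (hasSubgaussianMGF_of_mem_Icc_of_integral_eq_zero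
        ((hFm Z).sub_const _).aemeasurable (Eventually.of_forall hb) h0).mgf_le l
      refine this.trans_eq ?_
      congr 2
      push_cast
      rw [Real.norm_eq_abs, div_pow, sq_abs]
      ring
    set m := ∫ Y, f Y ∂(Measure.pi fun _ => ν)
    have hexp : ∀ {α : Type _} [MeasurableSpace α] (μ : Measure α) [IsFiniteMeasure μ] (h : α → ℝ),
        Measurable h → (∀ x, |h x| ≤ C) → Integrable (fun x => Real.exp (l * (h x - m))) μ := by
      intro α _ μ _ h hm hb
      refine integrable_of_abs_le (C := Real.exp (|l| * (C + |m|))) (by fun_prop) fun x => ?_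
      rw [abs_of_pos (Real.exp_pos _), Real.exp_le_exp]
      refine (le_abs_self _).trans ?_
      rw [abs_mul]
      refine mul_le_mul_of_nonneg_left ?_ (abs_nonneg l)
      exact (abs_sub _ _).trans (by linarith [hb x])
    have hprod : Integrable (fun z : E × (Fin n → E) => Real.exp (l * (F z.1 z.2 - m)))
        (ν.prod π) := hexp _ _ hcons fun z => hC _
    calc ∫ Y, Real.exp (l * (f Y - m)) ∂(Measure.pi fun _ => ν)
        = ∫ Z, ∫ y, Real.exp (l * (F y Z - m)) ∂ν ∂π := by
          rw [← hmp.map_eq, integral_map hmp.measurable.aemeasurable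
            (Measurable.aestronglyMeasurable (by fun_prop)), integral_prod_symm _ hprod]
      _ ≤ ∫ Z, Real.exp (d ^ 2 * l ^ 2 / 2) * Real.exp (l * (g Z - m)) ∂π := by
          refine integral_mono hprod.integral_prod_right ((hexp π g hgm hgC).const_mul _) fun Z => ?_
          have h1 : ∀ y, Real.exp (l * (F y Z - m)) =
              Real.exp (l * (F y Z - g Z)) * Real.exp (l * (g Z - m)) := fun y => by
            rw [← Real.exp_add]; ring_nf
          simp only [h1]
          rw [integral_mul_const]
          exact mul_le_mul_of_nonneg_right (hinner Z) (Real.exp_pos _).le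
      _ ≤ Real.exp (d ^ 2 * l ^ 2 / 2) * Real.exp (n * d ^ 2 * l ^ 2 / 2) := by
          rw [integral_const_mul, hint]
          exact mul_le_mul_of_nonneg_left (ih hgm hgC hgd) (Real.exp_pos _).le
      _ = Real.exp ((n + 1 : ℕ) * d ^ 2 * l ^ 2 / 2) := by
          rw [← Real.exp_add]
          push_cast
          ring_nf

/-- McDiarmid's bounded differences inequality (with a non-optimal constant). -/
theorem hasSubgaussianMGF_of_bounded_differences {d : ℝ≥0} {n : ℕ} {f : (Fin n → E) → ℝ}
    (hf : Measurable f) {C : ℝ} (hC : ∀ Y, |f Y| ≤ C)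
    (hd : ∀ Y k y, |f (Function.update Y k y) - f Y| ≤ d) :
    HasSubgaussianMGF (fun Y => f Y - ∫ Z, f Z ∂(Measure.pi fun _ => ν)) (n * d ^ 2)
      (Measure.pi fun _ => ν) where
  integrable_exp_mul l := integrable_exp_mul_of_mem_Icc
    (a := -C - ∫ Z, f Z ∂(Measure.pi fun _ => ν)) (b := C - ∫ Z, f Z ∂(Measure.pi fun _ => ν))
    (by fun_prop) (Eventually.of_forall fun Y => by
      have := abs_le.1 (hC Y)
      exact ⟨by linarith, by linarith⟩)
  mgf_le l := by
    refine (integral_exp_sub_integral_le ν hf hC hd l).trans_eq ?_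
    push_cast
    rfl

theorem measureReal_abs_sub_integral_ge_le {d : ℝ≥0} {n : ℕ} {f : (Fin n → E) → ℝ}
    (hf : Measurable f) {C : ℝ} (hC : ∀ Y, |f Y| ≤ C)
    (hd : ∀ Y k y, |f (Function.update Y k y) - f Y| ≤ d) {ε : ℝ} (hε : 0 ≤ ε) :
    (Measure.pi fun _ => ν).real {Y | ε ≤ |f Y - ∫ Z, f Z ∂(Measure.pi fun _ => ν)|} ≤
      2 * Real.exp (-ε ^ 2 / (2 * (n * d ^ 2))) := by
  have h := hasSubgaussianMGF_of_bounded_differences ν hf hC hd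
  have h1 := h.measure_ge_le hε
  have h2 := h.neg.measure_ge_le hε
  push_cast at h1 h2
  rw [two_mul]
  refine le_trans ?_ (add_le_add h1 h2)
  refine le_trans (measureReal_mono ?_) (measureReal_union_le _ _)
  intro Y hY
  exact le_abs.1 (Set.mem_ofPred.1 hY)

/-- Fubini: a bound uniform over the frozen other coordinates integrates to the same bound. This is
how independence of a column from its leave-one-out resolvent enters. -/
theorem measure_pi_le_of_forall_insertNth {n : ℕ} (k : Fin (n + 1)) {B : Set (Fin (n + 1) → E)}
    (hB : MeasurableSet B) {δ : ℝ≥0∞} (h : ∀ Z : Fin n → E, ν {y | k.insertNth y Z ∈ B} ≤ δ) :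
    Measure.pi (fun _ => ν) B ≤ δ := by
  have hmp := measurePreserving_insertNth ν k
  rw [← hmp.measure_preimage hB.nullMeasurableSet,
    Measure.prod_apply_symm (hmp.measurable hB)]
  refine (lintegral_mono fun Z => h Z).trans ?_
  simp

end BoundedDifferences

/-! ### Stability of the fixed point equation -/

section FixedPoint

theorem abs_div_one_add_sub_le {u v : ℝ} (hu : 0 ≤ u) (hv : 0 ≤ v) :
    |u / (1 + u) - v / (1 + v)| ≤ |u - v| := by
  have h : u / (1 + u) - v / (1 + v) = (u - v) / ((1 + u) * (1 + v)) := by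
    field_simp
    ring
  rw [h, abs_div, abs_of_pos (show 0 < (1 + u) * (1 + v) by positivity)]
  exact div_le_self (abs_nonneg _) (by nlinarith)

theorem abs_div_one_add_sub_le_one {u v : ℝ} (hu : 0 ≤ u) (hv : 0 ≤ v) :
    |u / (1 + u) - v / (1 + v)| ≤ 1 := by
  have h1 : ∀ w : ℝ, 0 ≤ w → 0 ≤ w / (1 + w) ∧ w / (1 + w) ≤ 1 := fun w hw =>
    ⟨by positivity, div_le_one_of_le₀ (by linarith) (by positivity)⟩
  obtain ⟨h2, h3⟩ := h1 u hu
  obtain ⟨h4, h5⟩ := h1 v hv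
  rw [abs_le]
  constructor <;> linarith

/-- The map `m ↦ t m + m/(1 + y m)` is a sum of `t m` and an increasing function on `[0, ∞)`, so it
expands distances by at least `t`, whatever `y ≥ 0`. -/
theorem mul_abs_sub_le_fixedPoint {t y m s : ℝ} (ht : 0 < t) (hy : 0 ≤ y) (hm : 0 ≤ m)
    (hs : 0 ≤ s) :
    t * |m - s| ≤ |(t * m + m / (1 + y * m)) - (t * s + s / (1 + y * s))| := by
  have h : (t * m + m / (1 + y * m)) - (t * s + s / (1 + y * s)) =
      (t + 1 / ((1 + y * m) * (1 + y * s))) * (m - s) := by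
    have h1 : 1 + y * m ≠ 0 := by positivity
    have h2 : 1 + y * s ≠ 0 := by positivity
    field_simp
    ring
  have h3 : 0 ≤ 1 / ((1 + y * m) * (1 + y * s)) := by positivity
  rw [h, abs_mul, abs_of_pos (add_pos_of_pos_of_nonneg ht h3)]
  exact mul_le_mul_of_nonneg_right (le_add_of_nonneg_right h3) (abs_nonneg _)

theorem tendsto_of_fixedPoint {t c s : ℝ} {y m : ℕ → ℝ} (ht : 0 < t) (hc : 0 ≤ c) (hs : 0 ≤ s)
    (hfix : t * s + s / (1 + c * s) = 1) (hy0 : ∀ n, 0 ≤ y n) (hm : ∀ n, 0 ≤ m n)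
    (hy : Tendsto y atTop (𝓝 c))
    (h : Tendsto (fun n => t * m n + m n / (1 + y n * m n)) atTop (𝓝 1)) :
    Tendsto m atTop (𝓝 s) := by
  have h1 : Tendsto (fun n => t * s + s / (1 + y n * s)) atTop (𝓝 1) := by
    have h0 : Tendsto (fun n => t * s + s / (1 + y n * s)) atTop (𝓝 (t * s + s / (1 + c * s))) :=
      tendsto_const_nhds.add (tendsto_const_nhds.div
        (tendsto_const_nhds.add (hy.mul_const s)) (by positivity))
    rwa [hfix] at h0
  have h2 := ((h.sub h1).abs).const_mul t⁻¹
  simp only [sub_self, abs_zero, mul_zero] at h2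
  rw [tendsto_iff_dist_tendsto_zero]
  refine squeeze_zero (fun _ => dist_nonneg) (fun n => ?_) h2
  rw [Real.dist_eq, ← div_eq_inv_mul, le_div_iff₀ ht, mul_comm]
  exact mul_abs_sub_le_fixedPoint ht (hy0 n) (hm n) hs

end FixedPoint

/-! ### Uniform form of assumption (A) -/

/-- For resolvents, the convergence of quadratic forms in assumption (A) is uniform. -/
theorem AssumptionA.uniform {Ω : Type*} [MeasurableSpace Ω] {P : Measure Ω}
    {x : (p : ℕ) → Ω → Fin p → ℝ} (hA : AssumptionA P x) {t ε : ℝ} (ht : 0 < t) (hε : 0 < ε)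
    {δ : ℝ≥0∞} (hδ : 0 < δ) :
    ∀ᶠ p : ℕ in atTop, ∀ A : Matrix (Fin p) (Fin p) ℝ, BoundedBelow t A →
      P {ω | ε * p ≤ |x p ω ⬝ᵥ A⁻¹ *ᵥ x p ω - A⁻¹.trace|} ≤ δ := by
  -- For each `p` choose a matrix violating the bound if there is one, and any admissible matrix
  -- otherwise. Applying (A) to this single sequence settles all matrices at once.
  have hex : ∀ p : ℕ, ∃ A : Matrix (Fin p) (Fin p) ℝ, BoundedBelow t A ∧
      (P {ω | ε * p ≤ |x p ω ⬝ᵥ A⁻¹ *ᵥ x p ω - A⁻¹.trace|} ≤ δ →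
        ∀ A : Matrix (Fin p) (Fin p) ℝ, BoundedBelow t A →
          P {ω | ε * p ≤ |x p ω ⬝ᵥ A⁻¹ *ᵥ x p ω - A⁻¹.trace|} ≤ δ) := by
    intro p
    by_contra! h
    obtain ⟨_, A, hA1, hA2⟩ := h _ (boundedBelow_smul_one t)
    exact absurd (h A hA1).1 (not_le.2 hA2)
  choose A hA1 hA2 using hex
  have h := tendstoInMeasure_iff_norm.1 (hA (fun p => (A p)⁻¹.map (fun r : ℝ => (r : ℂ)))
    ⟨1 / t, fun p => (hA1 p).matSpectralNorm_inv_le ht⟩) ε hε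
  filter_upwards [h.eventually_lt_const hδ, eventually_gt_atTop 0] with p hp hp0
  refine hA2 p (le_of_eq_of_le ?_ hp.le)
  congr 1
  ext ω
  have hp0' : (0 : ℝ) < p := by exact_mod_cast hp0
  have htr : ((A p)⁻¹.map (fun r : ℝ => (r : ℂ))).trace = (((A p)⁻¹.trace : ℝ) : ℂ) := by
    simp [Matrix.trace]
  simp only [Set.mem_ofPred_eq]
  rw [sub_zero, quadForm_map_ofReal, htr, ← Complex.ofReal_sub, norm_div, Complex.norm_real,
    Complex.norm_natCast, Real.norm_eq_abs, le_div_iff₀ hp0']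

/-! ### Concentration and approximate fixed point equation for the resolvent trace -/

/-- The normalized trace of the resolvent at `-t` of the sample covariance matrix with
columns `Y`. -/
noncomputable def resolventTrace {p n : ℕ} (t : ℝ) (Y : Fin n → Fin p → ℝ) : ℝ :=
  (p : ℝ)⁻¹ * (shiftedGram t (n : ℝ)⁻¹ Y)⁻¹.trace

section ResolventTrace

variable {p n : ℕ} {t : ℝ}

theorem resolventTrace_mem_Icc (ht : 0 < t) (Y : Fin n → Fin p → ℝ) :
    resolventTrace t Y ∈ Set.Icc 0 (1 / t) := by
  have h := (boundedBelow_shiftedGram (t := t) (a := (n : ℝ)⁻¹) (by positivity) Y).trace_inv_mem_Icc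
    ht
  rw [Fintype.card_fin] at h
  refine ⟨mul_nonneg (by positivity) h.1, ?_⟩
  refine (mul_le_mul_of_nonneg_left h.2 (by positivity)).trans ?_
  rw [← mul_div_assoc]
  exact div_le_div_of_nonneg_right (inv_mul_le_one) ht.le

theorem abs_resolventTrace_le (ht : 0 < t) (Y : Fin n → Fin p → ℝ) :
    |resolventTrace t Y| ≤ 1 / t := by
  have := resolventTrace_mem_Icc ht Y
  rw [abs_of_nonneg this.1]
  exact this.2

theorem measurable_resolventTrace (ht : 0 < t) :
    Measurable (resolventTrace t : (Fin n → Fin p → ℝ) → ℝ) := by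
  have := (continuous_shiftedGram_inv (ι := Fin p) (κ := Fin n) (a := (n : ℝ)⁻¹) ht
    (by positivity)).matrix_trace
  exact (continuous_const.mul this).measurable

/-- Both traces lie below the same leave-one-out trace by an amount in `[0, 1/t]`, hence differ by
at most `1/t` before normalization. -/
theorem abs_resolventTrace_update_sub_le (ht : 0 < t) (Y : Fin n → Fin p → ℝ) (k : Fin n)
    (y : Fin p → ℝ) :
    |resolventTrace t (Function.update Y k y) - resolventTrace t Y| ≤ 1 / (t * p) := by
  cases n with
  | zero => exact k.elim0
  | succ n =>
    have ha : (0 : ℝ) ≤ ((n + 1 : ℕ) : ℝ)⁻¹ := by positivity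
    rw [resolventTrace, resolventTrace, shiftedGram_eq_removeNth t _ Y k,
      shiftedGram_eq_removeNth t _ (Function.update Y k y) k, Fin.removeNth_update, ← mul_sub,
      abs_mul, abs_of_nonneg (by positivity), one_div, mul_inv, mul_comm]
    refine mul_le_mul_of_nonneg_right ?_ (by positivity)
    have hB := boundedBelow_shiftedGram (t := t) ha (k.removeNth Y)
    have h1 := hB.trace_inv_sub_mem_Icc ht ha (Y k)
    have h2 := hB.trace_inv_sub_mem_Icc ht ha (Function.update Y k y k)
    rw [one_div] at h1 h2
    rw [abs_le]
    constructor <;> linarith [h1.1, h1.2, h2.1, h2.2]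

variable (ν : Measure (Fin p → ℝ)) [IsProbabilityMeasure ν]

theorem measureReal_resolventTrace_le (n : ℕ) (ht : 0 < t) {ε : ℝ} (hε : 0 ≤ ε) :
    (Measure.pi fun _ : Fin n => ν).real
      {Y | ε ≤ |resolventTrace t Y - ∫ Z, resolventTrace t Z ∂(Measure.pi fun _ : Fin n => ν)|} ≤
      2 * Real.exp (-(ε ^ 2 * t ^ 2 / 2) * (p ^ 2 / n)) := by
  have h := measureReal_abs_sub_integral_ge_le ν (n := n) (d := ⟨1 / (t * p), by positivity⟩)
    (measurable_resolventTrace ht) (abs_resolventTrace_le ht)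
    (abs_resolventTrace_update_sub_le ht) hε
  refine h.trans_eq ?_
  congr 2
  change -ε ^ 2 / (2 * (n * (1 / (t * p)) ^ 2)) = _
  by_cases hn : (n : ℝ) = 0
  · simp [hn]
  by_cases hp : (p : ℝ) = 0
  · simp [hp]
  field_simp

/-- Each summand of the exact trace identity is close to `v/(1+v)` with `v = (p/n) m`. The errors
are `(p/n) ε` from the quadratic form, `1/(nt)` from the removed column and `(p/n) ε` from
concentration, plus the probabilities of the two exceptional events, where the trivial bound `1` is
used. Summing `n` terms and dividing by `p` multiplies everything by `n/p`. -/
theorem abs_fixedPoint_resolventTrace_le (hp : p ≠ 0) (hn : n ≠ 0) (ht : 0 < t) {ε δ : ℝ}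
    (hε : 0 ≤ ε) (hδ : 0 ≤ δ) (h : ∀ A : Matrix (Fin p) (Fin p) ℝ, BoundedBelow t A →
      ν {y | ε * p ≤ |y ⬝ᵥ A⁻¹ *ᵥ y - A⁻¹.trace|} ≤ ENNReal.ofReal δ) {m : ℝ}
    (hm : m = ∫ Y, resolventTrace t Y ∂(Measure.pi fun _ : Fin n => ν)) :
    |t * m + m / (1 + p / n * m) - 1| ≤
      2 * ε + 1 / (t * p) +
        n / p * (δ + 2 * Real.exp (-(ε ^ 2 * t ^ 2 / 2) * (p ^ 2 / n))) := by
  obtain ⟨n, rfl⟩ := Nat.exists_eq_succ_of_ne_zero hn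
  rw [Nat.succ_eq_add_one] at *
  set N : ℝ := ((n + 1 : ℕ) : ℝ) with hN
  have hN0 : 0 < N := by positivity
  have hp0 : (0 : ℝ) < p := by exact_mod_cast Nat.pos_of_ne_zero hp
  have ha : 0 ≤ N⁻¹ := by positivity
  set π := Measure.pi fun _ : Fin (n + 1) => ν with hπ
  have hm0 : 0 ≤ m := hm ▸ integral_nonneg fun Y => (resolventTrace_mem_Icc ht Y).1
  set q : Fin (n + 1) → (Fin (n + 1) → Fin p → ℝ) → ℝ := fun k Y =>
    Y k ⬝ᵥ (shiftedGram t N⁻¹ (k.removeNth Y))⁻¹ *ᵥ Y k with hq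
  have hq0 : ∀ k Y, 0 ≤ N⁻¹ * q k Y := fun k Y =>
    mul_nonneg ha ((boundedBelow_shiftedGram ha _).dotProduct_inv_nonneg ht _)
  have hRc : ∀ k : Fin (n + 1), Continuous fun Y : Fin (n + 1) → Fin p → ℝ =>
      (shiftedGram t N⁻¹ (k.removeNth Y))⁻¹ := fun k =>
    (continuous_shiftedGram_inv (κ := Fin n) ht ha).comp
      (by unfold Fin.removeNth; fun_prop)
  have hqc : ∀ k, Continuous (q k) := fun k =>
    (continuous_apply k).dotProduct ((hRc k).matrix_mulVec (continuous_apply k))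
  set φ : Fin (n + 1) → (Fin (n + 1) → Fin p → ℝ) → ℝ := fun k Y =>
    N⁻¹ * q k Y / (1 + N⁻¹ * q k Y) with hφ
  have hφc : ∀ k, Continuous (φ k) := fun k =>
    (continuous_const.mul (hqc k)).div (continuous_const.add (continuous_const.mul (hqc k)))
      fun Y => by have := hq0 k Y; positivity
  have hφ1 : ∀ k Y, |φ k Y| ≤ 1 := fun k Y => by
    simpa using abs_div_one_add_sub_le_one (hq0 k Y) le_rfl
  have hφi : ∀ k, Integrable (φ k) π := fun k =>
    integrable_of_abs_le (hφc k).measurable (hφ1 k)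
  set v := p / N * m with hv
  have hv0 : 0 ≤ v := by positivity
  -- the event where the normalized trace is far from its mean
  set B : Set (Fin (n + 1) → Fin p → ℝ) := {Y | ε ≤ |resolventTrace t Y - m|} with hB
  have hBm : MeasurableSet B :=
    measurableSet_le measurable_const ((measurable_resolventTrace ht).sub_const m).abs
  have hBle : π.real B ≤ 2 * Real.exp (-(ε ^ 2 * t ^ 2 / 2) * (p ^ 2 / N)) := by
    rw [hB, hm]
    exact measureReal_resolventTrace_le ν (n + 1) ht hε
  set D : Fin (n + 1) → Set (Fin (n + 1) → Fin p → ℝ) := fun k =>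
    {Y | ε * p ≤ |q k Y - (shiftedGram t N⁻¹ (k.removeNth Y))⁻¹.trace|} with hD
  have hDm : ∀ k, MeasurableSet (D k) := fun k =>
    measurableSet_le measurable_const ((hqc k).sub (hRc k).matrix_trace).abs.measurable
  have hDle : ∀ k, π.real (D k) ≤ δ := fun k => by
    refine ENNReal.toReal_le_of_le_ofReal hδ ?_
    refine measure_pi_le_of_forall_insertNth ν k (hDm k) fun Z => ?_
    refine le_of_eq_of_le ?_ (h _ (boundedBelow_shiftedGram ha Z))
    simp [hD, hq]
  have hdev : ∀ k, |∫ Y, φ k Y ∂π - v / (1 + v)| ≤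
      2 * (p / N) * ε + N⁻¹ / t +
        (δ + 2 * Real.exp (-(ε ^ 2 * t ^ 2 / 2) * (p ^ 2 / N))) := by
    intro k
    have hpt : ∀ Y, |φ k Y - v / (1 + v)| ≤ 2 * (p / N) * ε + N⁻¹ / t +
        ((D k).indicator 1 Y + B.indicator 1 Y) := by
      intro Y
      have hpos : 0 ≤ 2 * (p / N) * ε + N⁻¹ / t := by positivity
      have hind : ∀ S : Set (Fin (n + 1) → Fin p → ℝ), (0 : ℝ) ≤ S.indicator 1 Y := fun S =>
        Set.indicator_nonneg (fun _ _ => zero_le_one) Y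
      have h1 := abs_div_one_add_sub_le_one (hq0 k Y) hv0
      by_cases hYD : Y ∈ D k
      · rw [Set.indicator_of_mem hYD]
        have := hind B
        simp only [Pi.one_apply]
        linarith
      by_cases hYB : Y ∈ B
      · rw [Set.indicator_of_mem hYB]
        have := hind (D k)
        simp only [Pi.one_apply]
        linarith
      rw [Set.indicator_of_notMem hYD, Set.indicator_of_notMem hYB]
      refine (abs_div_one_add_sub_le (hq0 k Y) hv0).trans ?_
      have hD1 : |q k Y - (shiftedGram t N⁻¹ (k.removeNth Y))⁻¹.trace| < ε * p := not_le.1 hYD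
      have hB1 : |resolventTrace t Y - m| < ε := not_le.1 hYB
      have hT := (boundedBelow_shiftedGram (t := t) ha (k.removeNth Y)).trace_inv_sub_mem_Icc ht ha
        (Y k)
      rw [← shiftedGram_eq_removeNth] at hT
      set T := (shiftedGram t N⁻¹ (k.removeNth Y))⁻¹.trace
      have hS : (shiftedGram t N⁻¹ Y)⁻¹.trace = p * resolventTrace t Y := by
        rw [resolventTrace, mul_inv_cancel_left₀ hp0.ne']
      rw [hS] at hT
      -- The three differences are controlled by leaving `D k`, by the rank-one trace bound, and by
      -- leaving `B`, in this order.
      have hsplit : N⁻¹ * q k Y - v = N⁻¹ * (q k Y - T) +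
          (N⁻¹ * (T - p * resolventTrace t Y) + p / N * (resolventTrace t Y - m)) := by
        rw [hv]; ring
      rw [hsplit]
      refine (abs_add_le _ _).trans ?_
      have e1 : |N⁻¹ * (q k Y - T)| ≤ p / N * ε := by
        rw [abs_mul, abs_of_nonneg ha, div_eq_mul_inv, mul_comm (p : ℝ), mul_assoc, mul_comm _ ε]
        exact mul_le_mul_of_nonneg_left hD1.le ha
      have e2 : |N⁻¹ * (T - p * resolventTrace t Y)| ≤ N⁻¹ / t := by
        rw [abs_mul, abs_of_nonneg ha, abs_of_nonneg hT.1, div_eq_mul_one_div N⁻¹]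
        exact mul_le_mul_of_nonneg_left hT.2 ha
      have e3 : |p / N * (resolventTrace t Y - m)| ≤ p / N * ε := by
        rw [abs_mul, abs_of_nonneg (show 0 ≤ p / N by positivity)]
        exact mul_le_mul_of_nonneg_left hB1.le (by positivity)
      have e4 := abs_add_le (N⁻¹ * (T - p * resolventTrace t Y)) (p / N * (resolventTrace t Y - m))
      linarith
    have hi : ∀ S : Set (Fin (n + 1) → Fin p → ℝ), MeasurableSet S →
        Integrable (S.indicator (1 : (Fin (n + 1) → Fin p → ℝ) → ℝ)) π := fun S hS =>
      (integrable_const (1 : ℝ)).indicator hS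
    have hi2 : Integrable (fun Y => (D k).indicator (1 : (Fin (n + 1) → Fin p → ℝ) → ℝ) Y +
        B.indicator 1 Y) π := (hi _ (hDm k)).add (hi _ hBm)
    have hbound : Integrable (fun Y => 2 * (p / N) * ε + N⁻¹ / t +
        ((D k).indicator (1 : (Fin (n + 1) → Fin p → ℝ) → ℝ) Y + B.indicator 1 Y)) π :=
      (integrable_const _).add hi2
    have h1 : ∫ Y, φ k Y ∂π - v / (1 + v) = ∫ Y, (φ k Y - v / (1 + v)) ∂π := by
      rw [integral_sub (hφi k) (integrable_const _)]
      simp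
    rw [h1, ← Real.norm_eq_abs]
    refine (norm_integral_le_of_norm_le hbound (Eventually.of_forall hpt)).trans ?_
    rw [integral_add (integrable_const _) hi2,
      integral_add (hi _ (hDm k)) (hi _ hBm), integral_indicator_one (hDm k),
      integral_indicator_one hBm]
    have := hDle k
    simp only [integral_const, probReal_univ, one_smul]
    linarith
  have hid : ∀ Y, t * resolventTrace t Y + (p : ℝ)⁻¹ * ∑ k, φ k Y = 1 := fun Y => by
    have := trace_shiftedGram_inv ht ha Y
    rw [Fintype.card_fin] at this
    rw [resolventTrace, mul_left_comm, ← mul_add, this, inv_mul_cancel₀ hp0.ne']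
  have hsum : t * m + (p : ℝ)⁻¹ * ∑ k, ∫ Y, φ k Y ∂π = 1 := by
    rw [hm, ← integral_finsetSum _ fun k _ => hφi k, ← integral_const_mul, ← integral_const_mul,
      ← integral_add]
    · simp [hid]
    · exact (integrable_of_abs_le (measurable_resolventTrace ht)
        (abs_resolventTrace_le ht)).const_mul _
    · exact (integrable_finsetSum _ fun k _ => hφi k).const_mul _
  have hfin : t * m + m / (1 + p / N * m) - 1 =
      (p : ℝ)⁻¹ * ∑ k, (v / (1 + v) - ∫ Y, φ k Y ∂π) := by
    rw [← hsum, Finset.sum_sub_distrib, Finset.sum_const, Finset.card_univ, Fintype.card_fin,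
      nsmul_eq_mul, ← hN, hv]
    have : 1 + p / N * m ≠ 0 := by positivity
    field_simp
    ring
  rw [hfin, abs_mul, abs_of_pos (by positivity)]
  refine (mul_le_mul_of_nonneg_left ((Finset.abs_sum_le_sum_abs _ _).trans
    (Finset.sum_le_card_nsmul _ _ _ fun k _ => by rw [abs_sub_comm]; exact hdev k))
    (by positivity)).trans_eq ?_
  rw [Finset.card_univ, Fintype.card_fin, nsmul_eq_mul, ← hN]
  field_simp

end ResolventTrace

/-! ### Limit of the mean and almost sure convergence -/

section Asymptotics

variable {Ω : Type*} [MeasurableSpace Ω] {P : Measure Ω} [IsProbabilityMeasure P]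
  {x : (p : ℕ) → Ω → Fin p → ℝ} {p : ℕ → ℕ} {c t : ℝ}

theorem tendsto_atTop_of_ratio (hc : 0 < c)
    (hp : Tendsto (fun n : ℕ => (p n : ℝ) / (n : ℝ)) atTop (𝓝 c)) : Tendsto p atTop atTop := by
  refine tendsto_natCast_atTop_iff (R := ℝ).1 ?_
  refine (hp.pos_mul_atTop hc tendsto_natCast_atTop_atTop).congr' ?_
  filter_upwards [eventually_gt_atTop 0] with n hn
  exact div_mul_cancel₀ _ (by positivity)

/-- Eventually `p > cn/2`, so the concentration exponent, proportional to `p²/n`, grows at least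
linearly in `n`. -/
theorem eventually_sq_div_ge (hc : 0 < c)
    (hp : Tendsto (fun n : ℕ => (p n : ℝ) / (n : ℝ)) atTop (𝓝 c)) :
    ∀ᶠ n : ℕ in atTop, c ^ 2 / 4 * n ≤ (p n : ℝ) ^ 2 / n := by
  filter_upwards [hp.eventually_const_lt (half_lt_self hc), eventually_gt_atTop 0] with n h1 h2
  have hn : (0 : ℝ) < n := by exact_mod_cast h2
  rw [lt_div_iff₀ hn] at h1
  rw [le_div_iff₀ hn]
  nlinarith [mul_pos hc hn]

theorem tendsto_integral_resolventTrace (hx : ∀ p, AEMeasurable (x p) P) (hA : AssumptionA P x)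
    (hc : 0 < c) (hp : Tendsto (fun n : ℕ => (p n : ℝ) / (n : ℝ)) atTop (𝓝 c)) (ht : 0 < t) :
    Tendsto (fun n : ℕ => ∫ Y, resolventTrace t Y
        ∂(Measure.pi fun _ : Fin n => P.map (x (p n)))) atTop
      (𝓝 (∫ x, (x + t)⁻¹ ∂(mpLaw c))) := by
  have hprob : ∀ p, IsProbabilityMeasure (P.map (x p)) := fun p =>
    Measure.isProbabilityMeasure_map (hx p)
  have hpt := tendsto_atTop_of_ratio hc hp
  refine tendsto_of_fixedPoint (y := fun n => (p n : ℝ) / n) ht hc.le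
    (integral_mpLaw_inv_add_nonneg ht)
    (integral_mpLaw_inv_add_eq hc ht) (fun n => by positivity)
    (fun n => integral_nonneg fun Y => (resolventTrace_mem_Icc ht Y).1) hp ?_
  have hexp : ∀ ε : ℝ, 0 < ε → Tendsto (fun n : ℕ =>
      Real.exp (-(ε ^ 2 * t ^ 2 / 2) * ((p n : ℝ) ^ 2 / n))) atTop (𝓝 0) := by
    intro ε hε
    refine Real.tendsto_exp_atBot.comp (Tendsto.const_mul_atTop_of_neg ?_ ?_)
    · have : 0 < ε ^ 2 * t ^ 2 / 2 := by positivity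
      linarith
    · refine tendsto_atTop_mono' _ (eventually_sq_div_ge hc hp) ?_
      exact tendsto_natCast_atTop_atTop.const_mul_atTop (by positivity)
  have hratio : Tendsto (fun n : ℕ => (n : ℝ) / p n) atTop (𝓝 c⁻¹) :=
    (hp.inv₀ hc.ne').congr fun n => inv_div _ _
  have hpinv : Tendsto (fun n : ℕ => 1 / (t * (p n : ℝ))) atTop (𝓝 0) :=
    tendsto_const_nhds.div_atTop
      ((tendsto_natCast_atTop_atTop.comp hpt).const_mul_atTop ht)
  refine Metric.tendsto_nhds.2 fun η hη => ?_
  -- With `ε = η/4` and `δ = cη/4` the error bound tends to `2(η/4) + c⁻¹(cη/4) = 3η/4`, strictly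
  -- below `η`.
  have hε : 0 < η / 4 := by positivity
  have hδ : 0 < c * η / 4 := by positivity
  have hlim : Tendsto (fun n : ℕ => 2 * (η / 4) + 1 / (t * (p n : ℝ)) +
      n / p n * (c * η / 4 + 2 * Real.exp (-((η / 4) ^ 2 * t ^ 2 / 2) * ((p n : ℝ) ^ 2 / n))))
      atTop (𝓝 (2 * (η / 4) + 0 + c⁻¹ * (c * η / 4 + 2 * 0))) :=
    (tendsto_const_nhds.add hpinv).add
      (hratio.mul (tendsto_const_nhds.add ((hexp _ hε).const_mul 2)))
  have hlt : 2 * (η / 4) + 0 + c⁻¹ * (c * η / 4 + 2 * 0) < η := by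
    have : c⁻¹ * (c * η / 4 + 2 * 0) = η / 4 := by field_simp; ring
    linarith
  filter_upwards [hlim.eventually_lt_const hlt, eventually_ne_atTop 0, hpt.eventually_ne_atTop 0,
    hpt.eventually (hA.uniform ht hε (ENNReal.ofReal_pos.2 hδ))] with n h1 h2 h3 h4
  rw [Real.dist_eq]
  refine (abs_fixedPoint_resolventTrace_le (P.map (x (p n))) h3 h2 ht hε.le hδ.le
    (fun A hAt => ?_) rfl).trans_lt h1
  rw [Measure.map_apply_of_aemeasurable (hx _)]
  · exact h4 A hAt
  · refine measurableSet_le measurable_const (Continuous.measurable ?_)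
    have : Continuous fun y : Fin (p n) → ℝ => y ⬝ᵥ A⁻¹ *ᵥ y :=
      continuous_id.dotProduct (continuous_const.matrix_mulVec continuous_id)
    exact (this.sub continuous_const).abs

variable {X : (p n : ℕ) → Ω → Matrix (Fin p) (Fin n) ℝ}

theorem map_col_eq_pi (hindep : ∀ p n, iIndepFun (fun (k : Fin n) (ω : Ω) => (X p n ω).col k) P)
    (hident : ∀ p n (k : Fin n), IdentDistrib (fun ω => (X p n ω).col k) (x p) P P) (p n : ℕ) :
    P.map (fun ω k => (X p n ω).col k) = Measure.pi fun _ : Fin n => P.map (x p) := by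
  rw [(iIndepFun_iff_map_fun_eq_pi_map fun k => (hident p n k).aemeasurable_fst).1 (hindep p n)]
  congr
  ext1 k
  exact (hident p n k).map_eq

theorem ae_tendsto_resolventTrace_sub_integral
    (hindep : ∀ p n, iIndepFun (fun (k : Fin n) (ω : Ω) => (X p n ω).col k) P)
    (hident : ∀ p n (k : Fin n), IdentDistrib (fun ω => (X p n ω).col k) (x p) P P)
    (hx : ∀ p, AEMeasurable (x p) P) (hc : 0 < c)
    (hp : Tendsto (fun n : ℕ => (p n : ℝ) / (n : ℝ)) atTop (𝓝 c)) (ht : 0 < t) :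
    ∀ᵐ ω ∂P, Tendsto (fun n : ℕ => resolventTrace t (fun k => (X (p n) n ω).col k) -
      ∫ Y, resolventTrace t Y ∂(Measure.pi fun _ : Fin n => P.map (x (p n)))) atTop (𝓝 0) := by
  have hprob : ∀ p, IsProbabilityMeasure (P.map (x p)) := fun p =>
    Measure.isProbabilityMeasure_map (hx p)
  have hev : ∀ j : ℕ, ∀ᵐ ω ∂P, ∀ᶠ n : ℕ in atTop,
      |resolventTrace t (fun k => (X (p n) n ω).col k) -
        ∫ Y, resolventTrace t Y ∂(Measure.pi fun _ : Fin n => P.map (x (p n)))| <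
        1 / ((j : ℝ) + 1) := by
    intro j
    set ε : ℝ := 1 / ((j : ℝ) + 1) with hε
    have hε0 : 0 < ε := by positivity
    set S : ℕ → Set Ω := fun n => {ω | ε ≤ |resolventTrace t (fun k => (X (p n) n ω).col k) -
        ∫ Y, resolventTrace t Y ∂(Measure.pi fun _ : Fin n => P.map (x (p n)))|} with hS
    have hmeas : ∀ n, P.real (S n) ≤
        2 * Real.exp (-(ε ^ 2 * t ^ 2 / 2) * ((p n : ℝ) ^ 2 / n)) := by
      intro n
      refine le_of_eq_of_le ?_ (measureReal_resolventTrace_le (P.map (x (p n))) n ht hε0.le)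
      simp only [hS, ← map_col_eq_pi hindep hident]
      rw [measureReal_def, measureReal_def, Measure.map_apply_of_aemeasurable
          (aemeasurable_pi_lambda _ fun k => (hident (p n) n k).aemeasurable_fst)]
      · rfl
      · exact measurableSet_le measurable_const ((measurable_resolventTrace ht).sub_const _).abs
    -- The tail is eventually at most `2 exp(-κ n)`, a geometric series; Borel–Cantelli needs no
    -- relation between different `n`.
    set κ : ℝ := ε ^ 2 * t ^ 2 / 2 * (c ^ 2 / 4) with hκ
    have hκ0 : 0 < κ := by positivity
    have hsum : Summable fun n => P.real (S n) := by
      have hg : Summable fun n : ℕ => 2 * Real.exp (-κ) ^ n :=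
        (summable_geometric_of_lt_one (Real.exp_pos _).le
          (Real.exp_lt_one_iff.2 (by linarith))).mul_left 2
      refine Summable.of_norm_bounded_eventually_nat hg ?_
      filter_upwards [eventually_sq_div_ge hc hp] with n hn
      rw [Real.norm_of_nonneg measureReal_nonneg]
      refine (hmeas n).trans ?_
      rw [← Real.exp_nat_mul]
      refine mul_le_mul_of_nonneg_left (Real.exp_le_exp.2 ?_) zero_le_two
      have := mul_le_mul_of_nonneg_left hn (show 0 ≤ ε ^ 2 * t ^ 2 / 2 by positivity)
      rw [hκ]
      linarith
    have htsum : ∑' n, P (S n) ≠ ∞ := by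
      have := hsum.tsum_ofReal_ne_top
      simpa only [measureReal_def, ENNReal.ofReal_toReal (measure_ne_top P _)] using this
    filter_upwards [ae_eventually_notMem htsum] with ω hω
    exact hω.mono fun n hn => not_le.1 hn
  filter_upwards [ae_all_iff.2 hev] with ω hω
  refine Metric.tendsto_nhds.2 fun η hη => ?_
  obtain ⟨j, hj⟩ := exists_nat_one_div_lt hη
  filter_upwards [hω j] with n hn
  rw [Real.dist_eq, sub_zero]
  exact hn.trans hj

end Asymptotics

end MarchenkoPastur

/-! ### The Marchenko–Pastur theorem -/

theorem theorem1 {Ω : Type*} [MeasurableSpace Ω] (P : Measure Ω) [IsProbabilityMeasure P]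
    (x : (p : ℕ) → Ω → Fin p → ℝ)
    (hx : ∀ p, AEMeasurable (x p) P)
    (X : (p n : ℕ) → Ω → Matrix (Fin p) (Fin n) ℝ)
    (hindep : ∀ p n, iIndepFun (fun (k : Fin n) (ω : Ω) => (X p n ω).col k) P)
    (hident : ∀ p n (k : Fin n), IdentDistrib (fun ω => (X p n ω).col k) (x p) P P)
    (hA : MarchenkoPastur.AssumptionA P x)
    (p : ℕ → ℕ) (c : ℝ) (hc : 0 < c)
    (hp : Tendsto (fun n : ℕ => (p n : ℝ) / (n : ℝ)) atTop (𝓝 c)) :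
    ∀ᵐ ω ∂P, MarchenkoPastur.WeaklyConverges
      (fun n => MarchenkoPastur.esd (MarchenkoPastur.sampleCov_isHermitian (X (p n) n ω)))
      (MarchenkoPastur.mpLaw c) := by
  have hprob := MarchenkoPastur.isProbabilityMeasure_mpLaw hc
  have ht : ∀ m : ℕ, (0 : ℝ) < 1 + ((m : ℝ) + 1)⁻¹ := fun m => by positivity
  -- Only countably many `t` are involved, so one null set serves all bounded continuous test
  -- functions.
  have hconc := ae_all_iff.2 fun m : ℕ =>
    MarchenkoPastur.ae_tendsto_resolventTrace_sub_integral hindep hident hx hc hp (ht m)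
  filter_upwards [hconc] with ω hω
  refine MarchenkoPastur.weaklyConverges_of_stieltjes ?_
    (Eventually.of_forall fun n =>
      MarchenkoPastur.ae_esd_nonneg (MarchenkoPastur.posSemidef_sampleCov _))
    MarchenkoPastur.ae_mpLaw_nonneg fun m => ?_
  · filter_upwards [(MarchenkoPastur.tendsto_atTop_of_ratio hc hp).eventually_ne_atTop 0] with n hn
    exact MarchenkoPastur.isProbabilityMeasure_esd hn _
  · have h := (hω m).add (MarchenkoPastur.tendsto_integral_resolventTrace hx hA hc hp (ht m))
    rw [zero_add] at h
    refine h.congr fun n => ?_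
    rw [sub_add_cancel, MarchenkoPastur.integral_esd_inv_add
      (MarchenkoPastur.posSemidef_sampleCov _) (ht m), MarchenkoPastur.sampleCov_add_smul_one]
    rfl
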